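/- **Setting.** Let $d\in\{2,3\}$, let $\Omega\subset\mathbb R^d$ be a bounded open set with $\operatorname{int}\overline\Omega=\Omega$, let $\mathcal T_h$ be a (finite, conforming) simplicial triangulation of $\Omega$ with set $\mathcal E_h$ of interior $(d-1)$-dimensional faces, let $r,s\ge 0$ be integers, and write $\langle\cdot,\cdot\rangle$ for the $L^2(\Omega)$ inner product of scalar or vector fields. Put $U_h^{\rm grad}=\{u\in H^1_0(\Omega)^d: u|_K\in P_{r+1}(K)^d\ \forall K\in\mathcal T_h\}$, $U_h^{\rm div}=\{u\in H_0(\operatorname{div},\Omega): u|_K\in P_r(K)^d+xP_r(K)\ \forall K\}$, $F_h=\{f\in L^2(\Omega): f|_K\in P_s(K)\ \forall K\}$, and let $U_h^{\rm curl}$ be the space of $u\in H_0(\operatorname{curl},\Omega)$ with $u|_K\in P_r(K)^3+x\times P_r(K)^3$ if $d=3$ and $u|_K\in P_r(K)^2+(x_2,-x_1)P_r(K)$ if $d=2$, for all $K$. Let $W_h=U_h^{\rm curl}$ if $d=3$; if $d=2$ let $W_h$ be the space of fields $(0,0,f)$ with $f\in H^1_0(\Omega)$, $f|_K\in P_{r+1}(K)$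 for all $K$ (for $d=2$ planar fields are regarded as fields with values in $\mathbb R^3$ and third component $0$, and nothing depends on the third coordinate). Let $\pi_h^{\rm div}$ be the $L^2$-orthogonal projector onto $U_h^{\rm div}$, let $\operatorname{curl}_h:U_h^{\rm div}\to W_h$ be defined by $\langle\operatorname{curl}_hB,v\rangle=\langle B,\operatorname{curl}v\rangle$ for all $v\in W_h$, and set $$a(w,u,v)=-\int_\Omega w\cdot[u,v]\,dx,\qquad [u,v]=u\cdot\nabla v-v\cdot\nabla u,$$ $$b_h(f,g,u)=-\sum_{K\in\mathcal T_h}\int_K(u\cdot\nabla f)\,g\,dx+\sum_{e\in\mathcal E_h}\int_e u\cdot\llbracket f\rrbracket\{g\}\,ds,$$ $$d(u,v)=-\int_\Omega\big[\mu\nabla u:\nabla v+(\lambda+\mu)\operatorname{div}u\operatorname{div}v\big]dx,\qquad e_h(B,C)=-\nu\langle\operatorname{curl}_hB,\operatorname{curl}_hC\rangle,$$ where, on $e=K_1\cap K_2$ with $f_i=f|_{K_i}$, $n_1=-n_2$ the unit normal to $e$ pointing from $K_1$ to $K_2$, $\llbracket f\rrbracket=f_1n_1+f_2n_2$ and $\{f\}=\frac12(f_1+f_2)$.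 Let $\Delta t>0$, let the energy density $\epsilon$ be a $C^1$ function on an open set $I\subset\mathbb R$, and let $\delta(x,y)=\frac{\epsilon(y)-\epsilon(x)}{y-x}$ (with $\delta(x,x)=\epsilon'(x)$). **Scheme.** Let $u_k\in U_h^{\rm grad}$, $\rho_k\in F_h$, $B_k\in U_h^{\rm div}$ ($0\le k\le N$), where $\rho_k|_K$ takes values in $I$ on every closed element $K$. Write $u_{k+1/2}=\frac12(u_k+u_{k+1})$, and likewise for $\rho$, $B$, $\rho u$. Suppose that for every $0\le k<N$ there are $\theta\in F_h$, $H,U,\alpha\in U_h^{\rm curl}$ and $J,E\in W_h$ with $$\Big\langle\tfrac{\rho_{k+1}u_{k+1}-\rho_ku_k}{\Delta t},v\Big\rangle+a((\rho u)_{k+1/2},u_{k+1/2},v)+b_h(\theta,\rho_{k+1/2},v)+\langle\alpha,v\rangle=d(u_{k+1/2},v)\quad\forall v\in U_h^{\rm grad},$$ $$\Big\langle\tfrac{\rho_{k+1}-\rho_k}{\Delta t},\sigma\Big\rangle+b_h(\sigma,\rho_{k+1/2},u_{k+1/2})=0\quad\forall\sigma\in F_h,$$ $$\Big\langle\tfrac{B_{k+1}-B_k}{\Delta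 t},C\Big\rangle+\langle\operatorname{curl}E,C\rangle=-\nu\langle\operatorname{curl}J,C\rangle\quad\forall C\in U_h^{\rm div},$$ $$\langle\theta,\tau\rangle=\big\langle\tfrac12u_k\cdot u_{k+1}-\delta(\rho_k,\rho_{k+1}),\tau\big\rangle\ \ \forall\tau\in F_h,\qquad\langle J,K\rangle=\langle B_{k+1/2},\operatorname{curl}K\rangle\ \ \forall K\in W_h,$$ $$\langle H,G\rangle=\langle B_{k+1/2},G\rangle,\quad\langle U,G\rangle=\langle u_{k+1/2},G\rangle,\quad\langle\alpha,G\rangle=-\langle J\times H,G\rangle\ \ \forall G\in U_h^{\rm curl},\qquad\langle E,F\rangle=-\langle U\times H,F\rangle\ \ \forall F\in W_h.$$ Let $\ell(u,\rho,B)=\int_\Omega[\frac12\rho|u|^2-\epsilon(\rho)-\frac12|B|^2]\,dx$, and let $\mathcal E_k=\langle\rho_ku_k,u_k\rangle-\ell(u_k,\rho_k,B_k)$ be the total energy. **Claim.** If $\operatorname{div}B_0=0$, then $\operatorname{div}B_k\equiv0$ for all $0\le k\le N$, and for all $0\le k<N$: $$\int_\Omega\rho_{k+1}\,dx=\int_\Omega\rho_k\,dx,$$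 $$\frac{\mathcal E_{k+1}-\mathcal E_k}{\Delta t}=d(u_{k+1/2},u_{k+1/2})+e_h(B_{k+1/2},B_{k+1/2}),$$ $$\frac1{\Delta t}\Big(\int_\Omega A_{k+1}\cdot B_{k+1}\,dx-\int_\Omega A_k\cdot B_k\,dx\Big)=2e_h(B_{k+1/2},\pi_h^{\rm div}A_{k+1/2})$$ for all $A_k,A_{k+1}\in H_0(\operatorname{curl},\Omega)$ with $\operatorname{curl}A_k=B_k$, $\operatorname{curl}A_{k+1}=B_{k+1}$, where $A_{k+1/2}=\frac12(A_k+A_{k+1})$. **Zero viscosity.** The same holds, with $d=0$, for the scheme in which $u_k$ and the test functions $v$ belong to $U_h^{\rm div}$ and $a((\rho u)_{k+1/2},u_{k+1/2},v)$ is replaced by $a_h(u_{k+1/2};(\rho u)_{k+1/2},u_{k+1/2},v)$, where $$a_h(V;w,u,v)=\sum_{K}\int_Kw\cdot(v\cdot\nabla u-u\cdot\nabla v)\,dx+\sum_{e\in\mathcal E_h}\int_en\times(\{w\}+\alpha_e(V)\llbracket w\rrbracket)\cdot\llbracket u\times v\rrbracket\,ds,$$ $n=n_1$, $\llbracket\cdot\rrbracket$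 of a vector field is the difference of its traces from $K_1$ and $K_2$, and the $\alpha_e(V)$ are arbitrary real-valued functions on $e$. In the ideal case the conservation is exact: $\mathcal E_{k+1}=\mathcal E_k$ if $\nu=0$ and either $\mu=\lambda=0$ or the zero-viscosity scheme is used, and $\int_\Omega A_{k+1}\cdot B_{k+1}\,dx=\int_\Omega A_k\cdot B_k\,dx$ if $\nu=0$. -/

import Mathlib

open MeasureTheory Filter Topology
open scoped ContDiff InnerProductSpace

noncomputable section

namespace CompressibleMHD

/-! ### Points, fields and differential operators

The spatial dimension is `d = 2` or `d = 3`. In both cases vector fields take values in `ℝ³`. For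
`d = 3` this is the usual setting. For `d = 2` a planar vector field is one whose third component
vanishes, a field orthogonal to the plane (a "scalar" field) is one whose first two components
vanish, and nothing depends on the third coordinate, so that cross products and curls are the
three-dimensional ones. -/

/-- Points of `ℝ^d`. -/
abbrev Pt (d : ℕ) := EuclideanSpace ℝ (Fin d)

/-- The space `ℝ³` of values of vector fields. -/
abbrev Vec := EuclideanSpace ℝ (Fin 3)

/-- Vector fields on `ℝ^d` with values in `ℝ³`. -/
abbrev VField (d : ℕ) := Pt d → Vec

/-- The inclusion `ℝ^d → ℝ³` (the identity if `d = 3`, `(x, y) ↦ (x, y, 0)` if `d = 2`). -/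
def emb {d : ℕ} (x : Pt d) : Vec :=
  WithLp.toLp 2 fun i => if h : (i : ℕ) < d then x ⟨i, h⟩ else 0

/-- The cross product of `ℝ³`. -/
def cross (v w : Vec) : Vec := WithLp.toLp 2 (crossProduct v.ofLp w.ofLp)

/-- The partial derivative `∂ᵢ f`; it is zero in the direction orthogonal to the plane if
`d = 2`. Functions that are polynomial on each element are differentiated elementwise in this
way; the skeleton of the mesh is a null set, and for conforming functions the outcome is the weak
derivative. -/
def pd {d : ℕ} {F : Type*} [NormedAddCommGroup F] [NormedSpace ℝ F] (i : Fin 3) (f : Pt d → F)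
    (x : Pt d) : F :=
  if h : (i : ℕ) < d then fderiv ℝ f x (EuclideanSpace.single ⟨i, h⟩ (1 : ℝ)) else 0

/-- The curl of a vector field. -/
def curl {d : ℕ} (u : VField d) : VField d := fun x =>
  !₂[pd 1 u x 2 - pd 2 u x 1, pd 2 u x 0 - pd 0 u x 2, pd 0 u x 1 - pd 1 u x 0]

/-- The divergence of a vector field. -/
def dv {d : ℕ} (u : VField d) (x : Pt d) : ℝ := ∑ i : Fin 3, pd i u x i

/-- The directional derivative `u · ∇ f`. -/
def adv {d : ℕ} {F : Type*} [NormedAddCommGroup F] [NormedSpace ℝ F] (u : VField d) (f : Pt d → F)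
    (x : Pt d) : F :=
  ∑ i : Fin 3, u x i • pd i f x

/-- The Lie bracket `[u, v] = u · ∇ v - v · ∇ u`. -/
def bracket {d : ℕ} (u v : VField d) : VField d := fun x => adv u v x - adv v u x

/-- The `L²(Ω)` inner product of scalar or vector fields. -/
def ip {d : ℕ} {F : Type*} [NormedAddCommGroup F] [InnerProductSpace ℝ F] (Ω : Set (Pt d))
    (f g : Pt d → F) : ℝ :=
  ∫ x in Ω, ⟪f x, g x⟫_ℝ

/-! ### Sobolev spaces with homogeneous boundary conditions -/

/-- `φ ∈ C_c^∞(Ω)`. -/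
def IsTest {d : ℕ} {F : Type*} [NormedAddCommGroup F] [NormedSpace ℝ F] (Ω : Set (Pt d))
    (φ : Pt d → F) : Prop :=
  ContDiff ℝ ∞ φ ∧ HasCompactSupport φ ∧ tsupport φ ⊆ Ω

/-- `(u, w)` lies in the closure in `L²(Ω) × L²(Ω)` of the set of pairs `(φ, D φ)`,
`φ ∈ C_c^∞(Ω)³`, for a first order differential operator `D`. -/
def InClosure {d : ℕ} {G : Type*} [NormedAddCommGroup G] (Ω : Set (Pt d))
    (D : VField d → Pt d → G) (u : VField d) (w : Pt d → G) : Prop :=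
  MemLp u 2 (volume.restrict Ω) ∧ MemLp w 2 (volume.restrict Ω) ∧
    ∃ φ : ℕ → VField d, (∀ n, IsTest Ω (φ n)) ∧
      Tendsto (fun n => eLpNorm (φ n - u) 2 (volume.restrict Ω)) atTop (𝓝 0) ∧
      Tendsto (fun n => eLpNorm (D (φ n) - w) 2 (volume.restrict Ω)) atTop (𝓝 0)

/-- `u ∈ H¹₀(Ω)³`: the closure of `C_c^∞(Ω)³` in `H¹(Ω)³`. -/
def MemH10 {d : ℕ} (Ω : Set (Pt d)) (u : VField d) : Prop :=
  ∃ w : Pt d → Pt d →L[ℝ] Vec, InClosure Ω (fderiv ℝ) u w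

/-- `u ∈ H₀(div, Ω)` (square integrable fields with square integrable divergence and `u · n = 0`
on the boundary): the closure of `C_c^∞(Ω)³` in `H(div, Ω)`. -/
def MemH0div {d : ℕ} (Ω : Set (Pt d)) (u : VField d) : Prop :=
  ∃ w : Pt d → ℝ, InClosure Ω dv u w

/-- `u ∈ H₀(curl, Ω)` and `curl u = w` (square integrable fields with square integrable curl `w`
and `u × n = 0` on the boundary; `H₀(curl, Ω)` is the closure of `C_c^∞(Ω)³` in
`H(curl, Ω)`). -/
def HasCurl0 {d : ℕ} (Ω : Set (Pt d)) (u w : VField d) : Prop := InClosure Ω curl u w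

/-- `u ∈ H₀(curl, Ω)`. -/
def MemH0curl {d : ℕ} (Ω : Set (Pt d)) (u : VField d) : Prop := ∃ w : VField d, HasCurl0 Ω u w

/-- `div u = 0` in `Ω`, in the sense of distributions. -/
def IsDivFree {d : ℕ} (Ω : Set (Pt d)) (u : VField d) : Prop :=
  ∀ φ : Pt d → ℝ, IsTest Ω φ → ∫ x in Ω, adv u φ x = 0

/-! ### Triangulations -/

/-- A finite simplicial complex is a triangulation of `Ω` if its simplices fill the closure of
`Ω`; `Ω` is open and equal to the interior of its closure. -/
structure IsTriangulation {d : ℕ} (T : Geometry.SimplicialComplex ℝ (Pt d)) (Ω : Set (Pt d)) :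
    Prop where
  finite : T.faces.Finite
  space_eq : T.space = closure Ω
  interior_eq : interior (closure Ω) = Ω

/-- The elements of the mesh: the `d`-dimensional simplices, given by their vertices. -/
def elems {d : ℕ} (T : Geometry.SimplicialComplex ℝ (Pt d)) : Set (Finset (Pt d)) :=
  {K | K ∈ T.faces ∧ K.card = d + 1}

/-- The closed simplex with the given vertices. -/
def hull {d : ℕ} (K : Finset (Pt d)) : Set (Pt d) := convexHull ℝ (K : Set (Pt d))

/-- `e` is the common `(d - 1)`-dimensional face of the two different elements `K₁`, `K₂`. -/
def IsSides {d : ℕ} (T : Geometry.SimplicialComplex ℝ (Pt d)) (e K₁ K₂ : Finset (Pt d)) : Prop :=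
  K₁ ∈ elems T ∧ K₂ ∈ elems T ∧ K₁ ≠ K₂ ∧ e ⊆ K₁ ∧ e ⊆ K₂

/-- The interior `(d - 1)`-dimensional faces. -/
def intFaces {d : ℕ} (T : Geometry.SimplicialComplex ℝ (Pt d)) : Set (Finset (Pt d)) :=
  {e | e ∈ T.faces ∧ e.card = d ∧ ∃ K₁ K₂, IsSides T e K₁ K₂}

/-- The two elements `(K₁, K₂)` that share an interior face, labelled arbitrarily. -/
def sides {d : ℕ} (T : Geometry.SimplicialComplex ℝ (Pt d)) (e : Finset (Pt d)) :
    Finset (Pt d) × Finset (Pt d) :=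
  Classical.epsilon fun p => IsSides T e p.1 p.2

/-- The unit normal `n₁` to the interior face `e`, pointing from `K₁` to `K₂`; the opposite
normal `n₂` is `-n₁`. It is regarded as a vector of `ℝ³`. -/
def normal {d : ℕ} (T : Geometry.SimplicialComplex ℝ (Pt d)) (e : Finset (Pt d)) : Vec :=
  emb (Classical.epsilon fun n : Pt d =>
    ‖n‖ = 1 ∧ (∀ x ∈ e, ∀ y ∈ e, ⟪n, x - y⟫_ℝ = 0) ∧
      ∀ x ∈ e, ∀ z ∈ (sides T e).2, z ∉ e → 0 < ⟪n, z - x⟫_ℝ)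

/-- The restriction of a piecewise polynomial function to the closed element `K`: the continuous
extension of its restriction to the interior of `K`. -/
def tr {d : ℕ} {F : Type*} [NormedAddCommGroup F] (K : Finset (Pt d)) (f : Pt d → F) : Pt d → F :=
  extendFrom (interior (hull K)) f

/-- The difference `f₁ - f₂` of the traces of `f` on the interior face `e`. -/
def diffTr {d : ℕ} {F : Type*} [NormedAddCommGroup F] (T : Geometry.SimplicialComplex ℝ (Pt d))
    (e : Finset (Pt d)) (f : Pt d → F) (x : Pt d) : F :=
  tr (sides T e).1 f x - tr (sides T e).2 f x

/-- The jump `f₁ n₁ + f₂ n₂` of a scalar function on the interior face `e`. -/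
def jump {d : ℕ} (T : Geometry.SimplicialComplex ℝ (Pt d)) (e : Finset (Pt d)) (f : Pt d → ℝ)
    (x : Pt d) : Vec :=
  diffTr T e f x • normal T e

/-- The average `(f₁ + f₂) / 2` on the interior face `e`. -/
def avg {d : ℕ} {F : Type*} [NormedAddCommGroup F] [NormedSpace ℝ F]
    (T : Geometry.SimplicialComplex ℝ (Pt d)) (e : Finset (Pt d)) (f : Pt d → F) (x : Pt d) : F :=
  (1 / 2 : ℝ) • (tr (sides T e).1 f x + tr (sides T e).2 f x)

/-- The sum over the elements `K` of the integrals over `K`. -/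
def sumElems {d : ℕ} (T : Geometry.SimplicialComplex ℝ (Pt d)) (f : Pt d → ℝ) : ℝ :=
  ∑ᶠ K ∈ elems T, ∫ x in hull K, f x

/-- The sum over the interior faces `e` of the integrals over `e` with respect to the
`(d - 1)`-dimensional surface measure. -/
def sumFaces {d : ℕ} (T : Geometry.SimplicialComplex ℝ (Pt d))
    (f : Finset (Pt d) → Pt d → ℝ) : ℝ :=
  ∑ᶠ e ∈ intFaces T,
    ∫ x in hull e, f e x ∂(Measure.euclideanHausdorffMeasure (d - 1) : Measure (Pt d))

/-! ### Finite element spaces -/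

/-- Triples of polynomials in `d` variables. -/
abbrev VPoly (d : ℕ) := Fin 3 → MvPolynomial (Fin d) ℝ

/-- The vector field given by a triple of polynomials. -/
def VPoly.toVField {d : ℕ} (p : VPoly d) : VField d := fun x =>
  WithLp.toLp 2 fun i => MvPolynomial.eval (fun j => x j) (p i)

/-- All components have degree at most `r`. -/
def VPoly.DegLE {d : ℕ} (p : VPoly d) (r : ℕ) : Prop := ∀ i, (p i).totalDegree ≤ r

/-- The field is tangent to the plane if `d = 2` (no condition if `d = 3`). -/
def VPoly.InPlane {d : ℕ} (p : VPoly d) : Prop := d = 2 → p 2 = 0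

/-- The field is orthogonal to the plane if `d = 2` (no condition if `d = 3`). -/
def VPoly.Axial {d : ℕ} (p : VPoly d) : Prop := d = 2 → p 0 = 0 ∧ p 1 = 0

/-- `DG_s`: scalar functions that are polynomials of degree at most `s` on each element. -/
def DG {d : ℕ} (T : Geometry.SimplicialComplex ℝ (Pt d)) (s : ℕ) : Set (Pt d → ℝ) :=
  {f | ∀ K ∈ elems T, ∃ p : MvPolynomial (Fin d) ℝ, p.totalDegree ≤ s ∧
    ∀ x ∈ interior (hull K), f x = MvPolynomial.eval (fun j => x j) p}

/-- `(CG_{r+1})^d`: fields in `H¹₀(Ω)^d` that belong to `P_{r+1}(K)^d` on each element `K`. -/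
def CG {d : ℕ} (Ω : Set (Pt d)) (T : Geometry.SimplicialComplex ℝ (Pt d)) (r : ℕ) :
    Set (VField d) :=
  {u | MemH10 Ω u ∧ ∀ K ∈ elems T, ∃ p : VPoly d, p.InPlane ∧ p.DegLE (r + 1) ∧
    ∀ x ∈ interior (hull K), u x = p.toVField x}

/-- `RT_r` (Raviart-Thomas): fields in `H₀(div, Ω)` that belong to `P_r(K)^d + x P_r(K)` on each
element `K`. -/
def RT {d : ℕ} (Ω : Set (Pt d)) (T : Geometry.SimplicialComplex ℝ (Pt d)) (r : ℕ) :
    Set (VField d) :=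
  {u | MemH0div Ω u ∧ ∀ K ∈ elems T, ∃ (p : VPoly d) (q : MvPolynomial (Fin d) ℝ),
    p.InPlane ∧ p.DegLE r ∧ q.totalDegree ≤ r ∧
    ∀ x ∈ interior (hull K),
      u x = p.toVField x + MvPolynomial.eval (fun j => x j) q • emb x}

/-- `NED_r` (Nedelec, first kind): fields in `H₀(curl, Ω)` that on each element `K` belong to
`P_r(K)³ + x × P_r(K)³` if `d = 3`, and to `P_r(K)² + (x₂, -x₁) P_r(K)` if `d = 2`; note that
`(x₁, x₂, 0) × (0, 0, q) = (x₂ q, -x₁ q, 0)`. -/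
def NED {d : ℕ} (Ω : Set (Pt d)) (T : Geometry.SimplicialComplex ℝ (Pt d)) (r : ℕ) :
    Set (VField d) :=
  {u | MemH0curl Ω u ∧ ∀ K ∈ elems T, ∃ p q : VPoly d,
    p.InPlane ∧ q.Axial ∧ p.DegLE r ∧ q.DegLE r ∧
    ∀ x ∈ interior (hull K), u x = p.toVField x + cross (emb x) (q.toVField x)}

/-- The space of the auxiliary variables `J` and `E`: it is `NED_r` if `d = 3`; if `d = 2` it
consists of the fields `(0, 0, f)` with `f ∈ H¹₀(Ω)` continuous piecewise polynomial of degree at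
most `r + 1` (that is, `f` in the scalar space `CG_{r+1}`). -/
def AUX {d : ℕ} (Ω : Set (Pt d)) (T : Geometry.SimplicialComplex ℝ (Pt d)) (r : ℕ) :
    Set (VField d) :=
  if d = 2 then
    {u | MemH10 Ω u ∧ ∀ K ∈ elems T, ∃ p : VPoly d, p.Axial ∧ p.DegLE (r + 1) ∧
      ∀ x ∈ interior (hull K), u x = p.toVField x}
  else NED Ω T r

/-! ### Discrete operators and forms -/

/-- The element `P` of the finite element space `V` with `⟨P, C⟩ = ℓ(C)` for all `C ∈ V` (unique
up to null sets). -/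
def rieszRep {d : ℕ} (Ω : Set (Pt d)) (V : Set (VField d)) (ℓ : VField d → ℝ) : VField d :=
  Classical.epsilon fun P => P ∈ V ∧ ∀ C ∈ V, ip Ω P C = ℓ C

/-- The `L²(Ω)`-orthogonal projection onto a finite element space. -/
def l2Proj {d : ℕ} (Ω : Set (Pt d)) (V : Set (VField d)) (f : VField d) : VField d :=
  rieszRep Ω V fun C => ip Ω f C

/-- The discrete curl: `⟨curl_h B, v⟩ = ⟨B, curl v⟩` for all `v` in the space of `J` and `E`. -/
def curlh {d : ℕ} (Ω : Set (Pt d)) (T : Geometry.SimplicialComplex ℝ (Pt d)) (r : ℕ)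
    (B : VField d) : VField d :=
  rieszRep Ω (AUX Ω T r) fun v => ip Ω B (curl v)

/-- `e_h(B, C) = -ν ⟨curl_h B, curl_h C⟩`. -/
def eForm {d : ℕ} (Ω : Set (Pt d)) (T : Geometry.SimplicialComplex ℝ (Pt d)) (r : ℕ) (ν : ℝ)
    (B C : VField d) : ℝ :=
  -ν * ip Ω (curlh Ω T r B) (curlh Ω T r C)

/-- `b_h(f, g, u) = -∑_K ∫_K (u · ∇ f) g + ∑_e ∫_e u · ⟦f⟧ {g}`. The normal component of `u` is
single-valued on faces, so its trace may be taken from either side. -/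
def bForm {d : ℕ} (T : Geometry.SimplicialComplex ℝ (Pt d)) (f g : Pt d → ℝ) (u : VField d) : ℝ :=
  -sumElems T (fun x => adv u f x * g x) +
    sumFaces T fun e x => ⟪tr (sides T e).1 u x, jump T e f x⟫_ℝ * avg T e g x

/-- `a(w, u, v) = -∫ w · [u, v]`. -/
def aForm {d : ℕ} (Ω : Set (Pt d)) (w u v : VField d) : ℝ := -ip Ω w (bracket u v)

/-- `a_h(U; w, u, v) = ∑_K ∫_K w · (v · ∇ u - u · ∇ v)
+ ∑_e ∫_e n × ({w} + α_e(U) ⟦w⟧) · ⟦u × v⟧`, with `⟦·⟧` the difference of traces. -/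
def ahForm {d : ℕ} (T : Geometry.SimplicialComplex ℝ (Pt d))
    (α : Finset (Pt d) → VField d → Pt d → ℝ) (U w u v : VField d) : ℝ :=
  sumElems T (fun x => ⟪w x, adv v u x - adv u v x⟫_ℝ) +
    sumFaces T fun e x =>
      ⟪cross (normal T e) (avg T e w x + α e U x • diffTr T e w x),
        diffTr T e (fun y => cross (u y) (v y)) x⟫_ℝ

/-- `d(u, v) = -∫ [μ ∇u : ∇v + (λ + μ) div u div v]`. -/
def dForm {d : ℕ} (Ω : Set (Pt d)) (μ lam : ℝ) (u v : VField d) : ℝ :=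
  -∫ x in Ω, (μ * ∑ i : Fin 3, ⟪pd i u x, pd i v x⟫_ℝ + (lam + μ) * (dv u x * dv v x))

/-! ### The time-stepping scheme -/

/-- The treatment of the velocity: the scheme with viscosity coefficients `μ`, `λ` and no-slip
condition, or the scheme for zero viscosity with `u · n = 0` on the boundary and upwinding
coefficients `α`. -/
inductive Regime (d : ℕ)
  | viscous (μ lam : ℝ) : Regime d
  | inviscid (α : Finset (Pt d) → VField d → Pt d → ℝ) : Regime d

namespace Regime

/-- The space of velocities: `(CG_{r+1})^d`, and `RT_r` for zero viscosity. -/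
def velSpace {d : ℕ} (Ω : Set (Pt d)) (T : Geometry.SimplicialComplex ℝ (Pt d)) (r : ℕ) :
    Regime d → Set (VField d)
  | viscous _ _ => CG Ω T r
  | inviscid _ => RT Ω T r

/-- The advection form `(U; w, u, v)`: it is `a(w, u, v)`, and `a_h(U; w, u, v)` for zero
viscosity. -/
def advForm {d : ℕ} (Ω : Set (Pt d)) (T : Geometry.SimplicialComplex ℝ (Pt d)) :
    Regime d → VField d → VField d → VField d → VField d → ℝ
  | viscous _ _, _, w, u, v => aForm Ω w u v
  | inviscid α, U, w, u, v => ahForm T α U w u v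

/-- The viscous form `d(u, v)`; it is zero for zero viscosity. -/
def viscForm {d : ℕ} (Ω : Set (Pt d)) : Regime d → VField d → VField d → ℝ
  | viscous μ lam, u, v => dForm Ω μ lam u v
  | inviscid _, _, _ => 0

/-- There is no viscosity. -/
def NoViscosity {d : ℕ} : Regime d → Prop
  | viscous μ lam => μ = 0 ∧ lam = 0
  | inviscid _ => True

end Regime

/-- The midpoint `(f + g) / 2`. -/
def mid {d : ℕ} {F : Type*} [AddCommGroup F] [Module ℝ F] (f g : Pt d → F) : Pt d → F :=
  fun x => (1 / 2 : ℝ) • (f x + g x)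

/-- The difference quotient `(g - f) / Δt`, where `f` and `g` are values at successive times. -/
def dt {d : ℕ} {F : Type*} [AddCommGroup F] [Module ℝ F] (Δt : ℝ) (f g : Pt d → F) : Pt d → F :=
  fun x => (1 / Δt) • (g x - f x)

/-- `δ(x, y) = (ε(y) - ε(x)) / (y - x)`, with the value `ε'(x)` at `y = x`. -/
def diffQuot (ε : ℝ → ℝ) (x y : ℝ) : ℝ :=
  open Classical in if y = x then deriv ε x else (ε y - ε x) / (y - x)

/-- The equations of one time step from `(u₀, ρ₀, B₀)` to `(u₁, ρ₁, B₁)`, with the auxiliary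
variables `θ, J, H, U, E, α`. -/
structure StepEqs {d : ℕ} (Ω : Set (Pt d)) (T : Geometry.SimplicialComplex ℝ (Pt d)) (r s : ℕ)
    (m : Regime d) (ν : ℝ) (ε : ℝ → ℝ) (Δt : ℝ) (u₀ : VField d) (ρ₀ : Pt d → ℝ) (B₀ : VField d)
    (u₁ : VField d) (ρ₁ : Pt d → ℝ) (B₁ : VField d) (θ : Pt d → ℝ) (J H U E α : VField d) :
    Prop where
  mem_θ : θ ∈ DG T s
  mem_J : J ∈ AUX Ω T r
  mem_H : H ∈ NED Ω T r
  mem_U : U ∈ NED Ω T r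
  mem_E : E ∈ AUX Ω T r
  mem_α : α ∈ NED Ω T r
  velocity : ∀ v ∈ m.velSpace Ω T r,
    ip Ω (dt Δt (fun x => ρ₀ x • u₀ x) (fun x => ρ₁ x • u₁ x)) v
      + m.advForm Ω T (mid u₀ u₁) (mid (fun x => ρ₀ x • u₀ x) (fun x => ρ₁ x • u₁ x)) (mid u₀ u₁) v
      + bForm T θ (mid ρ₀ ρ₁) v + ip Ω α v = m.viscForm Ω (mid u₀ u₁) v
  density : ∀ σ ∈ DG T s, ip Ω (dt Δt ρ₀ ρ₁) σ + bForm T σ (mid ρ₀ ρ₁) (mid u₀ u₁) = 0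
  magnetic : ∀ C ∈ RT Ω T r,
    ip Ω (dt Δt B₀ B₁) C + ip Ω (curl E) C = -ν * ip Ω (curl J) C
  eq_θ : ∀ τ ∈ DG T s,
    ip Ω θ τ = ip Ω (fun x => (1 / 2) * ⟪u₀ x, u₁ x⟫_ℝ - diffQuot ε (ρ₀ x) (ρ₁ x)) τ
  eq_J : ∀ K ∈ AUX Ω T r, ip Ω J K = ip Ω (mid B₀ B₁) (curl K)
  eq_H : ∀ G ∈ NED Ω T r, ip Ω H G = ip Ω (mid B₀ B₁) G
  eq_U : ∀ V ∈ NED Ω T r, ip Ω U V = ip Ω (mid u₀ u₁) V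
  eq_E : ∀ F ∈ AUX Ω T r, ip Ω E F = -ip Ω (fun x => cross (U x) (H x)) F
  eq_α : ∀ β ∈ NED Ω T r, ip Ω α β = -ip Ω (fun x => cross (J x) (H x)) β

/-- `(u₁, ρ₁, B₁)` is obtained from `(u₀, ρ₀, B₀)` by one step of the scheme. -/
def IsStep {d : ℕ} (Ω : Set (Pt d)) (T : Geometry.SimplicialComplex ℝ (Pt d)) (r s : ℕ)
    (m : Regime d) (ν : ℝ) (ε : ℝ → ℝ) (Δt : ℝ) (u₀ : VField d) (ρ₀ : Pt d → ℝ) (B₀ : VField d)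
    (u₁ : VField d) (ρ₁ : Pt d → ℝ) (B₁ : VField d) : Prop :=
  ∃ (θ : Pt d → ℝ) (J H U E α : VField d),
    StepEqs Ω T r s m ν ε Δt u₀ ρ₀ B₀ u₁ ρ₁ B₁ θ J H U E α

/-- The Lagrangian `ℓ(u, ρ, B) = ∫ [½ ρ |u|² - ε(ρ) - ½ |B|²]`. -/
def lagrangian {d : ℕ} (Ω : Set (Pt d)) (ε : ℝ → ℝ) (u : VField d) (ρ : Pt d → ℝ) (B : VField d) :
    ℝ :=
  ∫ x in Ω, ((1 / 2) * ρ x * ‖u x‖ ^ 2 - ε (ρ x) - (1 / 2) * ‖B x‖ ^ 2)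

/-- The total energy `⟨δℓ/δu, u⟩ - ℓ(u, ρ, B)`, where `δℓ/δu = ρ u`. -/
def energy {d : ℕ} (Ω : Set (Pt d)) (ε : ℝ → ℝ) (u : VField d) (ρ : Pt d → ℝ) (B : VField d) : ℝ :=
  ip Ω (fun x => ρ x • u x) u - lagrangian Ω ε u ρ B

end CompressibleMHD

end

open CompressibleMHD

/-! Every balance law follows by inserting suitable discrete fields as test functions and
cancelling; no approximation property of the spaces is used.

Magnetic field. The curl maps the space of `J` and `E` into `RT` (`curl_mem_RT`), so the residual of
the magnetic equation is itself an admissible test field and vanishes almost everywhere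
(`StepEqs.faraday`). Thus the increment of `B` is a linear combination of curls of fields in
H₀(curl), and curls are divergence free. This rests on the fact that the elementwise curl of a
discrete field in H₀(curl) is its weak curl (`HasCurl0.ae_eq_curl`).

Mass. The form `bForm` vanishes when its first argument is constant, so the density equation is
tested with 1.

Energy. A discrete product rule and the difference quotient δ (`energy_sub_div`) write the energy
increment exactly as pairings of the time differences with the midpoint velocity, the variable θ and
the midpoint magnetic field. Testing with these fields, the advection term vanishes by antisymmetry,
the two `bForm` terms cancel, and the Lorentz force cancels the work of the electric field because
the triple product is antisymmetric. The viscous and resistive terms remain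
(`StepEqs.energy_balance`).

Helicity. The curl is symmetric on H₀(curl) (`HasCurl0.ip_comm`), so the helicity increment is twice
the pairing of the midpoint potential with the increment of `B`. The electric part of it is the
pairing of `B` with `E`, which is zero (`StepEqs.ip_mid_E`); the resistive part is rewritten with
the projection and the discrete curl (`StepEqs.helicity_balance`).

The discrete curl and the projection are chosen by `epsilon`; that they have their defining property
is the Riesz representation `exists_ip_eq`. -/

namespace CompressibleMHD

variable {d : ℕ} {Ω : Set (Pt d)} {T : Geometry.SimplicialComplex ℝ (Pt d)}

/-! ### The mesh -/

lemma convex_hull (K : Finset (Pt d)) : Convex ℝ (hull K) := convex_convexHull ℝ _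

lemma isCompact_hull (K : Finset (Pt d)) : IsCompact (hull K) :=
  K.finite_toSet.isCompact_convexHull (𝕜 := ℝ)

/-- At most `d` points span a proper affine subspace, which is a null set. -/
lemma volume_hull_eq_zero {K : Finset (Pt d)} (hK : K.card ≤ d) : volume (hull K) = 0 := by
  rcases K.eq_empty_or_nonempty with rfl | hne
  · simp [hull]
  have hspan : affineSpan ℝ (K : Set (Pt d)) ≠ ⊤ := by
    intro h
    have h1 : vectorSpan ℝ (K : Set (Pt d)) = ⊤ := by
      rw [← direction_affineSpan, h, AffineSubspace.direction_top]
    have hc : K.card = (K.card - 1) + 1 := by have := hne.card_pos; omega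
    have h2 := finrank_vectorSpan_range_le ℝ (fun x : K => (x : Pt d)) (n := K.card - 1)
      (by simpa using hc)
    have h3 : Set.range (fun x : K => (x : Pt d)) = (K : Set (Pt d)) := by simp
    rw [h3, h1, finrank_top, finrank_euclideanSpace_fin] at h2
    omega
  exact measure_mono_null (convexHull_subset_affineSpan _)
    (Measure.addHaar_affineSubspace volume _ hspan)

lemma interior_hull_nonempty {K : Finset (Pt d)} (hK : K ∈ elems T) :
    (interior (hull K)).Nonempty := by
  refine interior_convexHull_nonempty_iff_affineSpan_eq_top.2 ?_
  have h := (T.indep hK.1).affineSpan_eq_top_iff_card_eq_finrank_add_one.2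
    (by simp [hK.2])
  simpa using h

/-- A full-dimensional simplex is the closure of its interior; this makes `tr`, an extension by
limits from the interior, meaningful on the faces. -/
lemma hull_subset_closure_interior {K : Finset (Pt d)} (hK : K ∈ elems T) :
    hull K ⊆ closure (interior (hull K)) := by
  rw [(convex_hull K).closure_interior_eq_closure_of_nonempty_interior
    (interior_hull_nonempty hK)]
  exact subset_closure

lemma IsTriangulation.isOpen (hT : IsTriangulation T Ω) : IsOpen Ω :=
  hT.interior_eq ▸ isOpen_interior

lemma IsTriangulation.interior_hull_subset (hT : IsTriangulation T Ω) {K : Finset (Pt d)}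
    (hK : K ∈ elems T) : interior (hull K) ⊆ Ω := by
  rw [← hT.interior_eq, ← hT.space_eq]
  exact interior_mono (T.convexHull_subset_space hK.1)

lemma IsTriangulation.finite_elems (hT : IsTriangulation T Ω) : (elems T).Finite :=
  hT.finite.subset fun _ h => h.1

lemma card_le_of_mem_faces {K : Finset (Pt d)} (hK : K ∈ T.faces) : K.card ≤ d + 1 := by
  have h := (T.indep hK).card_le_finrank_succ
  have h2 := Submodule.finrank_le (vectorSpan ℝ (Set.range ((↑) : K → Pt d)))
  rw [finrank_euclideanSpace_fin] at h2
  simp only [Fintype.card_coe] at h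
  omega

/-- Almost every point of `Ω` is an interior point of an element. -/
lemma IsTriangulation.ae_subset (hT : IsTriangulation T Ω) :
    Ω ≤ᵐ[volume] (⋃ K ∈ elems T, interior (hull K) : Set (Pt d)) := by
  have hnull : volume (⋃ K ∈ T.faces, (hull K \ ⋃ K ∈ elems T, interior (hull K))) = 0 := by
    rw [measure_biUnion_null_iff hT.finite.countable]
    intro K hK
    rcases (card_le_of_mem_faces hK).lt_or_eq with hlt | heq
    · exact measure_mono_null Set.sdiff_subset (volume_hull_eq_zero (by omega))
    -- A `d`-simplex loses only its frontier, and the frontier of a convex set is null.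
    · refine measure_mono_null ?_ ((convex_hull K).addHaar_frontier volume)
      rw [frontier, (isCompact_hull K).isClosed.closure_eq]
      refine Set.sdiff_subset_sdiff_right ?_
      exact Set.subset_biUnion_of_mem (u := fun K => interior (hull K)) (show K ∈ elems T from ⟨hK, heq⟩)
  rw [ae_le_set]
  refine measure_mono_null ?_ hnull
  intro x hx
  have hx1 : x ∈ T.space := by rw [hT.space_eq]; exact subset_closure hx.1
  obtain ⟨K, hK, hxK⟩ := T.mem_space_iff.1 hx1
  exact Set.mem_biUnion hK ⟨hxK, hx.2⟩

lemma IsTriangulation.ae_eq (hT : IsTriangulation T Ω) :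
    Ω =ᵐ[volume] (⋃ K ∈ elems T, interior (hull K) : Set (Pt d)) := by
  have h : (⋃ K ∈ elems T, interior (hull K) : Set (Pt d)) ⊆ Ω :=
    Set.iUnion₂_subset fun _ hK => hT.interior_hull_subset hK
  exact EventuallyLE.antisymm hT.ae_subset (LE.le.eventuallyLE h)

lemma IsTriangulation.ae_restrict (hT : IsTriangulation T Ω) {P : Pt d → Prop}
    (h : ∀ K ∈ elems T, ∀ᵐ x, x ∈ interior (hull K) → P x) :
    ∀ᵐ x ∂volume.restrict Ω, P x := by
  rw [Measure.restrict_congr_set hT.ae_eq,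
    ae_restrict_biUnion_iff _ hT.finite_elems.countable]
  intro K hK
  rw [ae_restrict_iff' isOpen_interior.measurableSet]
  exact h K hK

lemma IsTriangulation.ae_of_forall (hT : IsTriangulation T Ω) {P : Pt d → Prop}
    (h : ∀ K ∈ elems T, ∀ x ∈ interior (hull K), P x) :
    ∀ᵐ x ∂volume.restrict Ω, P x :=
  hT.ae_restrict fun K hK => Eventually.of_forall (h K hK)

/-- The intersection is open, so it is empty once it is null; it lies in the simplex on the common
vertices, of which two different elements have at most `d`. -/
lemma disjoint_interior_hull {K L : Finset (Pt d)} (hK : K ∈ elems T) (hL : L ∈ elems T)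
    (hKL : K ≠ L) : Disjoint (interior (hull K)) (interior (hull L)) := by
  classical
  rw [Set.disjoint_iff_inter_eq_empty,
    ← (isOpen_interior.inter isOpen_interior).measure_eq_zero_iff volume]
  have hcard : (K ∩ L).card ≤ d := by
    by_contra! h
    have h1 := Finset.eq_of_subset_of_card_le (Finset.inter_subset_left (s₁ := K) (s₂ := L))
      (by rw [hK.2]; omega)
    have h2 := Finset.eq_of_subset_of_card_le (Finset.inter_subset_right (s₁ := K) (s₂ := L))
      (by rw [hL.2]; omega)
    exact hKL (h1.symm.trans h2)
  refine measure_mono_null ?_ (volume_hull_eq_zero hcard)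
  refine (Set.inter_subset_inter interior_subset interior_subset).trans ?_
  simpa [hull] using T.inter_subset_convexHull hK.1 hL.1

lemma IsTriangulation.integral_eq_sum (hT : IsTriangulation T Ω) {f : Pt d → ℝ}
    (hf : IntegrableOn f Ω) :
    ∫ x in Ω, f x = ∑ K ∈ hT.finite_elems.toFinset, ∫ x in interior (hull K), f x := by
  have h := integral_biUnion_finset (μ := volume) (f := f) hT.finite_elems.toFinset
    (s := fun K => interior (hull K)) (fun _ _ => isOpen_interior.measurableSet)
    (fun K hK L hL hKL => disjoint_interior_hull (by simpa using hK) (by simpa using hL) hKL)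
    (fun K hK => hf.mono_set (hT.interior_hull_subset (by simpa using hK)))
  rw [← h, setIntegral_congr_set hT.ae_eq]
  simp

/-! ### Elementwise continuous functions -/

/-- On each element the function agrees with a continuous function on the closed element. -/
def PwCont {F : Type*} [TopologicalSpace F] (T : Geometry.SimplicialComplex ℝ (Pt d))
    (f : Pt d → F) : Prop :=
  ∀ K ∈ elems T, ∃ g : Pt d → F, ContinuousOn g (hull K) ∧ Set.EqOn f g (interior (hull K))

section PwCont

variable {F G H : Type*} [TopologicalSpace F] [TopologicalSpace G] [TopologicalSpace H]

lemma PwCont.comp {f : Pt d → F} (hf : PwCont T f) {φ : F → G} (hφ : Continuous φ) :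
    PwCont T fun x => φ (f x) := fun K hK => by
  obtain ⟨f', hf', h⟩ := hf K hK
  exact ⟨fun x => φ (f' x), hφ.comp_continuousOn hf', fun x hx => by simp only [h hx]⟩

lemma PwCont.prodMk {f : Pt d → F} {g : Pt d → G} (hf : PwCont T f) (hg : PwCont T g) :
    PwCont T fun x => (f x, g x) := fun K hK => by
  obtain ⟨f', hf', h⟩ := hf K hK
  obtain ⟨g', hg', h'⟩ := hg K hK
  exact ⟨fun x => (f' x, g' x), hf'.prodMk hg', fun x hx => by simp only [h hx, h' hx]⟩

lemma PwCont.comp₂ {f : Pt d → F} {g : Pt d → G} (hf : PwCont T f) (hg : PwCont T g)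
    {φ : F → G → H} (hφ : Continuous fun p : F × G => φ p.1 p.2) :
    PwCont T fun x => φ (f x) (g x) := (hf.prodMk hg).comp hφ

lemma PwCont.const (c : F) : PwCont T fun _ => c :=
  fun _ _ => ⟨fun _ => c, continuousOn_const, fun _ _ => rfl⟩

end PwCont

lemma PwCont.integrableOn {F : Type*} [NormedAddCommGroup F] (hT : IsTriangulation T Ω)
    {f : Pt d → F} (hf : PwCont T f) : IntegrableOn f Ω := by
  refine IntegrableOn.mono_set_ae ?_ hT.ae_subset
  rw [integrableOn_finite_biUnion hT.finite_elems]
  intro K hK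
  obtain ⟨g, hg, h⟩ := hf K hK
  exact (integrableOn_congr_fun h isOpen_interior.measurableSet).2
    ((hg.integrableOn_compact (isCompact_hull K)).mono_set interior_subset)

lemma PwCont.memLp {F : Type*} [NormedAddCommGroup F] (hT : IsTriangulation T Ω)
    {f : Pt d → F} (hf : PwCont T f) : MemLp f 2 (volume.restrict Ω) := by
  rw [memLp_two_iff_integrable_sq_norm (hf.integrableOn hT).aestronglyMeasurable]
  exact (hf.comp (φ := fun y => ‖y‖ ^ 2) (by fun_prop)).integrableOn hT

/-! ### Calculus of smooth fields -/

/-- The `i`-th coordinate vector of `ℝ^d`, which is zero if `i ≥ d`. -/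
noncomputable def coordVec (d : ℕ) (i : Fin 3) : Pt d :=
  if h : (i : ℕ) < d then EuclideanSpace.single ⟨i, h⟩ (1 : ℝ) else 0

section pd

variable {F : Type*} [NormedAddCommGroup F] [NormedSpace ℝ F]

/-- The case distinction moves into the direction vector, so that `pd` is linear in the derivative
with one formula for both dimensions. -/
lemma pd_eq (i : Fin 3) (f : Pt d → F) (x : Pt d) : pd i f x = fderiv ℝ f x (coordVec d i) := by
  unfold pd coordVec
  split_ifs <;> simp

lemma pd_apply (i j : Fin 3) {u : VField d} {x : Pt d} (hu : DifferentiableAt ℝ u x) :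
    pd i u x j = pd i (fun y => u y j) x := by
  rw [pd_eq, pd_eq]
  have h := (EuclideanSpace.proj j : Vec →L[ℝ] ℝ).hasFDerivAt.comp x hu.hasFDerivAt
  have h' : HasFDerivAt (fun y => u y j)
      ((EuclideanSpace.proj j : Vec →L[ℝ] ℝ).comp (fderiv ℝ u x)) x := h
  rw [h'.fderiv]
  rfl

lemma pd_const (i : Fin 3) (c : F) (x : Pt d) : pd i (fun _ => c) x = 0 := by
  rw [pd_eq]; simp

lemma pd_sub (i : Fin 3) {f g : Pt d → ℝ} {x : Pt d} (hf : DifferentiableAt ℝ f x)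
    (hg : DifferentiableAt ℝ g x) : pd i (fun y => f y - g y) x = pd i f x - pd i g x := by
  simp only [pd_eq]
  rw [fderiv_fun_sub hf hg]; rfl

lemma pd_add (i : Fin 3) {f g : Pt d → ℝ} {x : Pt d} (hf : DifferentiableAt ℝ f x)
    (hg : DifferentiableAt ℝ g x) : pd i (fun y => f y + g y) x = pd i f x + pd i g x := by
  simp only [pd_eq]
  rw [fderiv_fun_add hf hg]; rfl

lemma pd_mul (i : Fin 3) {f g : Pt d → ℝ} {x : Pt d} (hf : DifferentiableAt ℝ f x)
    (hg : DifferentiableAt ℝ g x) :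
    pd i (fun y => f y * g y) x = f x * pd i g x + g x * pd i f x := by
  simp only [pd_eq]
  rw [fderiv_fun_mul hf hg]; simp

lemma contDiff_pd {f : Pt d → F} (hf : ContDiff ℝ ∞ f) (i : Fin 3) :
    ContDiff ℝ ∞ (pd i f) := by
  have h : pd i f = fun x => fderiv ℝ f x (coordVec d i) := funext (pd_eq i f)
  rw [h]
  exact (hf.fderiv_right (by simp)).clm_apply contDiff_const

lemma pd_comm (i j : Fin 3) {f : Pt d → F} (hf : ContDiff ℝ ∞ f) (x : Pt d) :
    pd i (pd j f) x = pd j (pd i f) x := by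
  have h (k : Fin 3) : pd k f = fun x => fderiv ℝ f x (coordVec d k) :=
    funext (pd_eq k f)
  have hd : DifferentiableAt ℝ (fderiv ℝ f) x :=
    ((hf.fderiv_right (m := ∞) (by simp)).differentiable (by simp)) x
  rw [h i, h j, pd_eq, pd_eq, fderiv_clm_apply hd (differentiableAt_const _),
    fderiv_clm_apply hd (differentiableAt_const _)]
  have hs : IsSymmSndFDerivAt ℝ f x := hf.contDiffAt.isSymmSndFDerivAt (by simp; exact WithTop.coe_le_coe.2 (le_top : (2 : ℕ∞) ≤ ⊤))
  simpa using hs (coordVec d i) (coordVec d j)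

end pd

lemma cross_apply_zero (v w : Vec) : cross v w 0 = v 1 * w 2 - v 2 * w 1 := by
  simp [cross, cross_apply]

lemma cross_apply_one (v w : Vec) : cross v w 1 = v 2 * w 0 - v 0 * w 2 := by
  simp [cross, cross_apply]

lemma cross_apply_two (v w : Vec) : cross v w 2 = v 0 * w 1 - v 1 * w 0 := by
  simp [cross, cross_apply]

lemma inner_vec (v w : Vec) : ⟪v, w⟫_ℝ = v 0 * w 0 + v 1 * w 1 + v 2 * w 2 := by
  simp [PiLp.inner_apply, Fin.sum_univ_three, mul_comm]

/-- Antisymmetry of the triple product; it cancels the Lorentz force against the electric field in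
the energy balance. -/
lemma inner_cross_swap (u v w : Vec) : ⟪cross u v, w⟫_ℝ = -⟪cross w v, u⟫_ℝ := by
  simp only [inner_vec, cross_apply_zero, cross_apply_one, cross_apply_two]
  ring

lemma inner_cross_self (v w : Vec) : ⟪cross v w, w⟫_ℝ = 0 := by
  simp only [inner_vec, cross_apply_zero, cross_apply_one, cross_apply_two]
  ring

lemma cross_self_eq_zero (v : Vec) : cross v v = 0 := by
  simp [cross]

lemma contDiff_cross {n : WithTop ℕ∞} : ContDiff ℝ n fun p : Vec × Vec => cross p.1 p.2 := by
  rw [contDiff_euclidean]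
  intro i
  fin_cases i
  · simp only [Fin.zero_eta, cross_apply_zero]; fun_prop
  · simp only [Fin.mk_one, cross_apply_one]; fun_prop
  · simp only [Fin.reduceFinMk, cross_apply_two]; fun_prop

/-- The linear map that sends the derivative of a field to its curl. -/
noncomputable def curlMap (d : ℕ) : (Pt d →L[ℝ] Vec) →L[ℝ] Vec :=
  LinearMap.toContinuousLinearMap
    { toFun := fun M => !₂[M (coordVec d 1) 2 - M (coordVec d 2) 1,
        M (coordVec d 2) 0 - M (coordVec d 0) 2, M (coordVec d 0) 1 - M (coordVec d 1) 0]
      map_add' := fun M N => by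
        ext i; fin_cases i <;> simp <;> ring
      map_smul' := fun c M => by
        ext i; fin_cases i <;> simp <;> ring }

/-- The linear map that sends the derivative of a field to its divergence. -/
noncomputable def divMap (d : ℕ) : (Pt d →L[ℝ] Vec) →L[ℝ] ℝ :=
  LinearMap.toContinuousLinearMap
    { toFun := fun M => ∑ i : Fin 3, M (coordVec d i) i
      map_add' := fun M N => by simp [Finset.sum_add_distrib]
      map_smul' := fun c M => by simp [Finset.mul_sum] }

lemma curl_eq (u : VField d) : curl u = fun x => curlMap d (fderiv ℝ u x) := by
  funext x
  simp only [curl, pd_eq]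
  rfl

lemma dv_eq (u : VField d) : dv u = fun x => divMap d (fderiv ℝ u x) := by
  funext x
  simp only [dv, pd_eq]
  rfl

lemma curl_apply_zero {u : VField d} {x : Pt d} (hu : DifferentiableAt ℝ u x) :
    curl u x 0 = pd 1 (fun y => u y 2) x - pd 2 (fun y => u y 1) x := by
  simp [curl, pd_apply _ _ hu]

lemma curl_apply_one {u : VField d} {x : Pt d} (hu : DifferentiableAt ℝ u x) :
    curl u x 1 = pd 2 (fun y => u y 0) x - pd 0 (fun y => u y 2) x := by
  simp [curl, pd_apply _ _ hu]

lemma curl_apply_two {u : VField d} {x : Pt d} (hu : DifferentiableAt ℝ u x) :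
    curl u x 2 = pd 0 (fun y => u y 1) x - pd 1 (fun y => u y 0) x := by
  simp [curl, pd_apply _ _ hu]

lemma dv_apply {u : VField d} {x : Pt d} (hu : DifferentiableAt ℝ u x) :
    dv u x = pd 0 (fun y => u y 0) x + pd 1 (fun y => u y 1) x + pd 2 (fun y => u y 2) x := by
  simp [dv, Fin.sum_univ_three, pd_apply _ _ hu]

lemma differentiableAt_apply {u : VField d} {x : Pt d} (hu : DifferentiableAt ℝ u x) (j : Fin 3) :
    DifferentiableAt ℝ (fun y => u y j) x :=
  differentiableAt_euclidean.1 hu j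

lemma dv_cross {u v : VField d} {x : Pt d} (hu : DifferentiableAt ℝ u x)
    (hv : DifferentiableAt ℝ v x) :
    dv (fun y => cross (u y) (v y)) x = ⟪curl u x, v x⟫_ℝ - ⟪u x, curl v x⟫_ℝ := by
  have hd := differentiableAt_apply hu
  have he := differentiableAt_apply hv
  have hc : DifferentiableAt ℝ (fun y => cross (u y) (v y)) x :=
    DifferentiableAt.comp (g := fun p : Vec × Vec => cross p.1 p.2) x
      ((contDiff_cross (n := 1)).differentiable (by simp) (u x, v x)) (hu.prodMk hv)
  rw [dv_apply hc]
  simp only [cross_apply_zero, cross_apply_one, cross_apply_two]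
  have hm (i j : Fin 3) : DifferentiableAt ℝ (fun y => u y i * v y j) x := (hd i).mul (he j)
  rw [pd_sub _ (hm _ _) (hm _ _), pd_sub _ (hm _ _) (hm _ _), pd_sub _ (hm _ _) (hm _ _)]
  simp only [pd_mul _ (hd _) (he _), inner_vec, curl_apply_zero hu, curl_apply_one hu,
    curl_apply_two hu, curl_apply_zero hv, curl_apply_one hv, curl_apply_two hv]
  ring

lemma adv_apply (u : VField d) (f : Pt d → ℝ) (x : Pt d) :
    adv u f x = u x 0 * pd 0 f x + u x 1 * pd 1 f x + u x 2 * pd 2 f x := by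
  simp [adv, Fin.sum_univ_three]

lemma dv_smul {u : VField d} {f : Pt d → ℝ} {x : Pt d} (hu : DifferentiableAt ℝ u x)
    (hf : DifferentiableAt ℝ f x) :
    dv (fun y => f y • u y) x = adv u f x + f x * dv u x := by
  have hd := differentiableAt_apply hu
  rw [dv_apply (u := fun y => f y • u y) (hf.smul hu), dv_apply hu, adv_apply]
  simp only [PiLp.smul_apply, smul_eq_mul, pd_mul _ hf (hd _)]
  ring

lemma contDiff_curl {u : VField d} (hu : ContDiff ℝ ∞ u) : ContDiff ℝ ∞ (curl u) := by
  rw [curl_eq]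
  exact (curlMap d).contDiff.comp (hu.fderiv_right (by simp))

lemma dv_curl {u : VField d} (hu : ContDiff ℝ ∞ u) (x : Pt d) : dv (curl u) x = 0 := by
  have hdu : Differentiable ℝ u := hu.differentiable (by simp)
  have hc : ∀ j, ContDiff ℝ ∞ fun y => u y j := fun j => contDiff_euclidean.1 hu j
  have hp : ∀ i j, DifferentiableAt ℝ (pd i fun y => u y j) x := fun i j =>
    (contDiff_pd (hc j) i).differentiable (by simp) x
  rw [dv_apply ((contDiff_curl hu).differentiable (by simp) x)]
  simp only [fun y => curl_apply_zero (hdu y), fun y => curl_apply_one (hdu y),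
    fun y => curl_apply_two (hdu y)]
  have e (i j k : Fin 3) : pd i (fun y => pd j (fun y => u y k) y) x
      = pd j (fun y => pd i (fun y => u y k) y) x := pd_comm i j (hc k) x
  rw [pd_sub _ (hp _ _) (hp _ _), pd_sub _ (hp _ _) (hp _ _), pd_sub _ (hp _ _) (hp _ _),
    e 0 1, e 0 2, e 1 2]
  ring

/-! ### Test functions -/

section IsTest

variable {F G : Type*} [NormedAddCommGroup F] [NormedSpace ℝ F] [NormedAddCommGroup G]
  [NormedSpace ℝ G]

lemma IsTest.mono {U : Set (Pt d)} {φ : Pt d → F} (h : IsTest U φ) (hU : U ⊆ Ω) : IsTest Ω φ :=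
  ⟨h.1, h.2.1, h.2.2.trans hU⟩

lemma isTest_fderiv {φ : Pt d → F} (h : IsTest Ω φ) : IsTest Ω (fderiv ℝ φ) :=
  ⟨h.1.fderiv_right (by simp), h.2.1.fderiv ℝ, (tsupport_fderiv_subset ℝ).trans h.2.2⟩

/-- A smooth function that vanishes where a test function vanishes is a test function. -/
lemma IsTest.of_support {φ : Pt d → F} (h : IsTest Ω φ) {ψ : Pt d → G} (hψ : ContDiff ℝ ∞ ψ)
    (hs : ∀ x, φ x = 0 → ψ x = 0) : IsTest Ω ψ := by
  have hsub : Function.support ψ ⊆ Function.support φ := fun x hx h0 => hx (hs x h0)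
  exact ⟨hψ, h.2.1.mono hsub, (closure_mono hsub).trans h.2.2⟩

lemma IsTest.comp_clm {φ : Pt d → F} (h : IsTest Ω φ) (L : F →L[ℝ] G) :
    IsTest Ω fun x => L (φ x) :=
  h.of_support (L.contDiff.comp h.1) fun x hx => by simp [hx]

lemma isTest_curl {φ : VField d} (h : IsTest Ω φ) : IsTest Ω (curl φ) := by
  rw [curl_eq]; exact (isTest_fderiv h).comp_clm _

lemma isTest_dv {φ : VField d} (h : IsTest Ω φ) : IsTest Ω (dv φ) := by
  rw [dv_eq]; exact (isTest_fderiv h).comp_clm _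

lemma isTest_pd {φ : Pt d → F} (h : IsTest Ω φ) (i : Fin 3) : IsTest Ω (pd i φ) := by
  have e : pd i φ = fun x =>
    ContinuousLinearMap.apply ℝ F (coordVec d i) (fderiv ℝ φ x) := funext (pd_eq i φ)
  rw [e]; exact (isTest_fderiv h).comp_clm _

lemma IsTest.integrable {φ : Pt d → F} (h : IsTest Ω φ) : Integrable φ :=
  h.1.continuous.integrable_of_hasCompactSupport h.2.1

lemma IsTest.memLp {φ : Pt d → F} (h : IsTest Ω φ) : MemLp φ 2 (volume.restrict Ω) :=
  (h.1.continuous.memLp_of_hasCompactSupport h.2.1).restrict Ω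

lemma IsTest.differentiable {φ : Pt d → F} (h : IsTest Ω φ) : Differentiable ℝ φ :=
  h.1.differentiable (by simp)

lemma IsTest.linearComb {φ ψ : Pt d → F} (hφ : IsTest Ω φ) (hψ : IsTest Ω ψ) (a b : ℝ) :
    IsTest Ω fun x => a • φ x + b • ψ x := by
  have h1 : IsTest Ω fun x => a • φ x :=
    hφ.of_support (hφ.1.const_smul a) fun x hx => by simp [hx]
  have h2 : IsTest Ω fun x => b • ψ x :=
    hψ.of_support (hψ.1.const_smul b) fun x hx => by simp [hx]
  exact ⟨h1.1.add h2.1, h1.2.1.add h2.2.1, (tsupport_add _ _).trans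
    (Set.union_subset h1.2.2 h2.2.2)⟩

lemma IsTest.eq_zero {φ : Pt d → F} (h : IsTest Ω φ) {x : Pt d} (hx : x ∉ Ω) : φ x = 0 :=
  image_eq_zero_of_notMem_tsupport fun h' => hx (h.2.2 h')

end IsTest

lemma IsTest.integral_pd {f : Pt d → ℝ} (h : IsTest Ω f) (i : Fin 3) : ∫ x, pd i f x = 0 := by
  have hi : Integrable fun x => fderiv ℝ f x (coordVec d i) := by
    have := (isTest_pd h i).integrable
    rwa [show pd i f = fun x => fderiv ℝ f x (coordVec d i) from funext (pd_eq i f)] at this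
  -- Integration by parts against the constant 1, whose derivative is zero.
  have := integral_mul_fderiv_eq_neg_fderiv_mul_of_integrable (μ := volume)
    (f := fun _ : Pt d => (1 : ℝ)) (g := f) (v := coordVec d i)
    (by simp) (by simpa using hi) (by simpa using h.integrable)
    (fun x _ => differentiableAt_const _) (fun x _ => h.differentiable x)
  simpa [pd_eq] using this

lemma IsTest.integral_dv {φ : VField d} (h : IsTest Ω φ) : ∫ x, dv φ x = 0 := by
  have hj (j : Fin 3) : IsTest Ω fun x => φ x j :=
    h.comp_clm (EuclideanSpace.proj j : Vec →L[ℝ] ℝ)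
  simp only [fun x => dv_apply (h.differentiable x)]
  rw [integral_add (f := fun x => pd 0 (fun y => φ y 0) x + pd 1 (fun y => φ y 1) x)
    ((isTest_pd (hj 0) 0).integrable.add (isTest_pd (hj 1) 1).integrable)
    (isTest_pd (hj 2) 2).integrable, integral_add (isTest_pd (hj 0) 0).integrable (isTest_pd (hj 1) 1).integrable,
    (hj 0).integral_pd, (hj 1).integral_pd, (hj 2).integral_pd]
  simp

/-- The divergence of `φ × ψ` integrates to zero. Compact support of one factor is enough, which
allows `ψ` to be a polynomial field. -/
lemma IsTest.integral_inner_curl {φ ψ : VField d} (hφ : IsTest Ω φ) (hψ : ContDiff ℝ ∞ ψ) :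
    ∫ x, ⟪curl φ x, ψ x⟫_ℝ = ∫ x, ⟪φ x, curl ψ x⟫_ℝ := by
  have h1 : IsTest Ω fun x => ⟪curl φ x, ψ x⟫_ℝ :=
    (isTest_curl hφ).of_support ((isTest_curl hφ).1.inner ℝ hψ) fun x hx => by simp [hx]
  have h2 : IsTest Ω fun x => ⟪φ x, curl ψ x⟫_ℝ :=
    hφ.of_support (hφ.1.inner ℝ (contDiff_curl hψ)) fun x hx => by simp [hx]
  have h3 : IsTest Ω fun x => cross (φ x) (ψ x) :=
    hφ.of_support (contDiff_cross.comp (hφ.1.prodMk hψ)) fun x hx => by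
      simp [hx, cross]
  have h4 := h3.integral_dv
  simp only [fun x => dv_cross (hφ.differentiable x) (hψ.differentiable (by simp) x)] at h4
  rw [integral_sub h1.integrable h2.integrable] at h4
  linarith

lemma IsTest.integral_adv {φ : VField d} (hφ : IsTest Ω φ) {f : Pt d → ℝ} (hf : IsTest Ω f) :
    ∫ x, adv φ f x = -∫ x, f x * dv φ x := by
  have h1 : IsTest Ω fun x => f x • φ x :=
    hφ.of_support (hf.1.smul hφ.1) fun x hx => by simp [hx]
  have h2 : IsTest Ω fun x => f x * dv φ x :=
    hf.of_support (hf.1.mul (isTest_dv hφ).1) fun x hx => by simp [hx]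
  have h4 := h1.integral_dv
  simp only [fun x => dv_smul (hφ.differentiable x) (hf.differentiable x)] at h4
  have h3 : Integrable (adv φ f) := by
    have e : adv φ f = fun x => dv (fun x => f x • φ x) x - f x * dv φ x := by
      funext x
      rw [dv_smul (hφ.differentiable x) (hf.differentiable x)]; ring
    rw [e]
    exact (isTest_dv h1).integrable.sub h2.integrable
  rw [integral_add h3 h2.integrable] at h4
  linarith

/-! ### The `L²` inner product -/

section ip

variable {F : Type*} [NormedAddCommGroup F] [InnerProductSpace ℝ F]

lemma ip_comm (f g : Pt d → F) : ip Ω f g = ip Ω g f := by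
  simp only [ip, real_inner_comm]

lemma ip_congr {f f' g g' : Pt d → F} (hf : f =ᵐ[volume.restrict Ω] f')
    (hg : g =ᵐ[volume.restrict Ω] g') : ip Ω f g = ip Ω f' g' := by
  refine integral_congr_ae ?_
  filter_upwards [hf, hg] with x h1 h2
  rw [h1, h2]

lemma memLp_integrable_inner {f g : Pt d → F} (hf : MemLp f 2 (volume.restrict Ω))
    (hg : MemLp g 2 (volume.restrict Ω)) : IntegrableOn (fun x => ⟪f x, g x⟫_ℝ) Ω := by
  refine (L2.integrable_inner (𝕜 := ℝ) (hf.toLp f) (hg.toLp g)).congr ?_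
  filter_upwards [hf.coeFn_toLp, hg.coeFn_toLp] with x h1 h2
  rw [h1, h2]

lemma ip_eq_inner {f g : Pt d → F} (hf : MemLp f 2 (volume.restrict Ω))
    (hg : MemLp g 2 (volume.restrict Ω)) : ip Ω f g = ⟪hf.toLp f, hg.toLp g⟫_ℝ := by
  rw [L2.inner_def]
  exact ip_congr hf.coeFn_toLp.symm hg.coeFn_toLp.symm

lemma ip_linearComb_left {f g h : Pt d → F} (hf : MemLp f 2 (volume.restrict Ω))
    (hg : MemLp g 2 (volume.restrict Ω)) (hh : MemLp h 2 (volume.restrict Ω)) (a b : ℝ) :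
    ip Ω (fun x => a • f x + b • g x) h = a * ip Ω f h + b * ip Ω g h := by
  simp only [ip, inner_add_left, real_inner_smul_left]
  rw [integral_add ((memLp_integrable_inner hf hh).const_mul a)
    ((memLp_integrable_inner hg hh).const_mul b), integral_const_mul, integral_const_mul]

lemma ip_linearComb_right {f g h : Pt d → F} (hf : MemLp f 2 (volume.restrict Ω))
    (hg : MemLp g 2 (volume.restrict Ω)) (hh : MemLp h 2 (volume.restrict Ω)) (a b : ℝ) :
    ip Ω h (fun x => a • f x + b • g x) = a * ip Ω h f + b * ip Ω h g := by
  rw [ip_comm, ip_linearComb_left hf hg hh, ip_comm f, ip_comm g]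

lemma ae_eq_zero_of_ip_self {f : Pt d → F} (hf : MemLp f 2 (volume.restrict Ω))
    (h : ip Ω f f = 0) : ∀ᵐ x ∂volume.restrict Ω, f x = 0 := by
  rw [ip_eq_inner hf hf, inner_self_eq_zero] at h
  have h1 := hf.coeFn_toLp
  rw [h] at h1
  filter_upwards [h1, Lp.coeFn_zero F 2 (volume.restrict Ω)] with x h2 h3
  rw [← h2, h3]; rfl

lemma tendsto_ip {f : ℕ → Pt d → F} {u v : Pt d → F}
    (hf : ∀ n, MemLp (f n) 2 (volume.restrict Ω)) (hu : MemLp u 2 (volume.restrict Ω))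
    (hv : MemLp v 2 (volume.restrict Ω))
    (h : Tendsto (fun n => eLpNorm (f n - u) 2 (volume.restrict Ω)) atTop (𝓝 0)) :
    Tendsto (fun n => ip Ω (f n) v) atTop (𝓝 (ip Ω u v)) := by
  simp only [fun n => ip_eq_inner (hf n) hv, ip_eq_inner hu hv]
  exact ((Lp.tendsto_Lp_iff_tendsto_eLpNorm'' f hf u hu).2 h).inner tendsto_const_nhds

end ip

lemma IsTest.setIntegral_inner {ψ : VField d} (hψ : IsTest Ω ψ) (f : VField d) :
    ip Ω f ψ = ∫ x, ⟪f x, ψ x⟫_ℝ :=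
  setIntegral_eq_integral_of_forall_compl_eq_zero fun x hx => by simp [hψ.eq_zero hx]

/-! ### Closures of differential operators -/

lemma tendsto_eLpNorm_linearComb {G : Type*} [NormedAddCommGroup G] [NormedSpace ℝ G]
    {f g : ℕ → Pt d → G} {u v : Pt d → G}
    (hf : ∀ n, MemLp (f n) 2 (volume.restrict Ω)) (hg : ∀ n, MemLp (g n) 2 (volume.restrict Ω))
    (hu : MemLp u 2 (volume.restrict Ω)) (hv : MemLp v 2 (volume.restrict Ω))
    (h : Tendsto (fun n => eLpNorm (f n - u) 2 (volume.restrict Ω)) atTop (𝓝 0))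
    (h' : Tendsto (fun n => eLpNorm (g n - v) 2 (volume.restrict Ω)) atTop (𝓝 0)) (a b : ℝ) :
    Tendsto (fun n => eLpNorm ((fun x => a • f n x + b • g n x) - fun x => a • u x + b • v x) 2
      (volume.restrict Ω)) atTop (𝓝 0) := by
  have e (n : ℕ) : ((fun x => a • f n x + b • g n x) - fun x => a • u x + b • v x)
      = a • (f n - u) + b • (g n - v) := by
    funext x
    simp only [Pi.sub_apply, Pi.add_apply, Pi.smul_apply, smul_sub]
    abel
  have hlim : Tendsto (fun n => ‖a‖ₑ * eLpNorm (f n - u) 2 (volume.restrict Ω)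
      + ‖b‖ₑ * eLpNorm (g n - v) 2 (volume.restrict Ω)) atTop (𝓝 (‖a‖ₑ * 0 + ‖b‖ₑ * 0)) :=
    (ENNReal.Tendsto.const_mul h (Or.inr (by simp))).add
      (ENNReal.Tendsto.const_mul h' (Or.inr (by simp)))
  simp only [mul_zero, add_zero] at hlim
  refine tendsto_of_tendsto_of_tendsto_of_le_of_le tendsto_const_nhds hlim
    (fun n => zero_le) fun n => ?_
  simp only [e n]
  refine (eLpNorm_add_le (((hf n).sub hu).const_smul a).1 (((hg n).sub hv).const_smul b).1
    (by norm_num)).trans ?_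
  rw [eLpNorm_const_smul, eLpNorm_const_smul]

section InClosure

variable {G : Type*} [NormedAddCommGroup G] [NormedSpace ℝ G]

/-- Factoring `D` through a linear map of the derivative treats the curl, the divergence and the
full derivative at once. -/
lemma InClosure.linearComb {D : VField d → Pt d → G} (L : (Pt d →L[ℝ] Vec) →L[ℝ] G)
    (hD : ∀ u, D u = fun x => L (fderiv ℝ u x)) {u v : VField d} {w z : Pt d → G}
    (hu : InClosure Ω D u w) (hv : InClosure Ω D v z) (a b : ℝ) :
    InClosure Ω D (fun x => a • u x + b • v x) fun x => a • w x + b • z x := by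
  obtain ⟨hu1, hw, φ, hφ, h1, h2⟩ := hu
  obtain ⟨hv1, hz, ψ, hψ, h3, h4⟩ := hv
  have hDt {φ : VField d} (h : IsTest Ω φ) : IsTest Ω (D φ) := by
    rw [hD]; exact (isTest_fderiv h).comp_clm L
  refine ⟨(hu1.const_smul a).add (hv1.const_smul b), (hw.const_smul a).add (hz.const_smul b),
    fun n x => a • φ n x + b • ψ n x, fun n => (hφ n).linearComb (hψ n) a b,
    tendsto_eLpNorm_linearComb (fun n => (hφ n).memLp) (fun n => (hψ n).memLp) hu1 hv1 h1 h3 a b,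
    ?_⟩
  have e (n : ℕ) : D (fun x => a • φ n x + b • ψ n x) = fun x => a • D (φ n) x + b • D (ψ n) x := by
    funext x
    simp only [hD]
    have ha : DifferentiableAt ℝ (fun x => a • φ n x) x := ((hφ n).differentiable x).const_smul a
    have hb : DifferentiableAt ℝ (fun x => b • ψ n x) x := ((hψ n).differentiable x).const_smul b
    rw [fderiv_fun_add ha hb,
      fderiv_fun_const_smul ((hφ n).differentiable x),
      fderiv_fun_const_smul ((hψ n).differentiable x)]
    simp
  simp only [e]
  exact tendsto_eLpNorm_linearComb (fun n => (hDt (hφ n)).memLp) (fun n => (hDt (hψ n)).memLp)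
    hw hz h2 h4 a b

end InClosure

lemma InClosure.congr_right {G : Type*} [NormedAddCommGroup G] {D : VField d → Pt d → G} {u : VField d} {w z : Pt d → G}
    (hu : InClosure Ω D u w) (h : w =ᵐ[volume.restrict Ω] z) : InClosure Ω D u z := by
  obtain ⟨hu1, hw, φ, hφ, h1, h2⟩ := hu
  refine ⟨hu1, (memLp_congr_ae h).1 hw, φ, hφ, h1, ?_⟩
  have e (n : ℕ) : eLpNorm (D (φ n) - z) 2 (volume.restrict Ω)
      = eLpNorm (D (φ n) - w) 2 (volume.restrict Ω) :=
    eLpNorm_congr_ae (by filter_upwards [h] with x hx; simp [hx])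
  simpa only [e] using h2

lemma HasCurl0.linearComb {u v w z : VField d} (hu : HasCurl0 Ω u w) (hv : HasCurl0 Ω v z)
    (a b : ℝ) : HasCurl0 Ω (fun x => a • u x + b • v x) fun x => a • w x + b • z x :=
  InClosure.linearComb (curlMap d) curl_eq hu hv a b

lemma MemH0curl.linearComb {u v : VField d} (hu : MemH0curl Ω u) (hv : MemH0curl Ω v)
    (a b : ℝ) : MemH0curl Ω fun x => a • u x + b • v x :=
  let ⟨_, hw⟩ := hu
  let ⟨_, hz⟩ := hv
  ⟨_, HasCurl0.linearComb hw hz a b⟩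

lemma MemH0div.linearComb {u v : VField d} (hu : MemH0div Ω u) (hv : MemH0div Ω v)
    (a b : ℝ) : MemH0div Ω fun x => a • u x + b • v x :=
  let ⟨_, hw⟩ := hu
  let ⟨_, hz⟩ := hv
  ⟨_, InClosure.linearComb (divMap d) dv_eq hw hz a b⟩

lemma MemH10.linearComb {u v : VField d} (hu : MemH10 Ω u) (hv : MemH10 Ω v)
    (a b : ℝ) : MemH10 Ω fun x => a • u x + b • v x :=
  let ⟨_, hw⟩ := hu
  let ⟨_, hz⟩ := hv
  ⟨_, InClosure.linearComb (ContinuousLinearMap.id ℝ _) (fun _ => rfl) hw hz a b⟩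

/-- The same approximating sequence works, since the curl is a bounded linear function of the
derivative. This puts the planar space `AUX` into H₀(curl). -/
lemma MemH10.memH0curl {u : VField d} (hu : MemH10 Ω u) : MemH0curl Ω u := by
  obtain ⟨w, hu1, hw, φ, hφ, h1, h2⟩ := hu
  refine ⟨fun x => curlMap d (w x), hu1, (curlMap d).comp_memLp' hw, φ, hφ, h1, ?_⟩
  have hlim := ENNReal.Tendsto.const_mul (a := ENNReal.ofReal ‖curlMap d‖) h2 (Or.inr (by simp))
  rw [mul_zero] at hlim
  refine tendsto_of_tendsto_of_tendsto_of_le_of_le tendsto_const_nhds hlim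
    (fun n => zero_le) fun n => ?_
  refine eLpNorm_le_mul_eLpNorm_of_ae_le_mul (Eventually.of_forall fun x => ?_) 2
  rw [curl_eq]
  simp only [Pi.sub_apply]
  rw [← map_sub]
  exact (curlMap d).le_opNorm _

/-! ### Weak curl: integration by parts, uniqueness, elementwise computation -/

lemma HasCurl0.ip_test {u w ψ : VField d} (hu : HasCurl0 Ω u w) (hψ : IsTest Ω ψ) :
    ip Ω w ψ = ip Ω u (curl ψ) := by
  obtain ⟨hu1, hw, φ, hφ, h1, h2⟩ := hu
  have l1 := tendsto_ip (fun n => (isTest_curl (hφ n)).memLp) hw hψ.memLp h2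
  have l2 := tendsto_ip (fun n => (hφ n).memLp) hu1 (isTest_curl hψ).memLp h1
  have e (n : ℕ) : ip Ω (curl (φ n)) ψ = ip Ω (φ n) (curl ψ) := by
    rw [hψ.setIntegral_inner, (isTest_curl hψ).setIntegral_inner,
      (hφ n).integral_inner_curl hψ.1]
  simp only [e] at l1
  exact tendsto_nhds_unique l1 l2

/-- Integration by parts in `H₀(curl, Ω)`. -/
lemma HasCurl0.ip_comm {u w v z : VField d} (hu : HasCurl0 Ω u w) (hv : HasCurl0 Ω v z) :
    ip Ω w v = ip Ω u z := by
  obtain ⟨hv1, hz, φ, hφ, h1, h2⟩ := hv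
  have l1 := tendsto_ip (fun n => (hφ n).memLp) hv1 hu.2.1 h1
  have l2 := tendsto_ip (fun n => (isTest_curl (hφ n)).memLp) hz hu.1 h2
  have e (n : ℕ) : ip Ω (φ n) w = ip Ω (curl (φ n)) u := by
    rw [CompressibleMHD.ip_comm, HasCurl0.ip_test hu (hφ n), CompressibleMHD.ip_comm]
  simp only [e] at l1
  rw [CompressibleMHD.ip_comm, tendsto_nhds_unique l1 l2, CompressibleMHD.ip_comm]

/-- The fundamental lemma of the calculus of variations for vector fields. -/
lemma ae_eq_zero_of_forall_isTest {U : Set (Pt d)} (hU : IsOpen U) {w : VField d}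
    (hw : LocallyIntegrableOn w U) (h : ∀ ψ : VField d, IsTest U ψ → ∫ x, ⟪w x, ψ x⟫_ℝ = 0) :
    ∀ᵐ x, x ∈ U → w x = 0 := by
  have hj (j : Fin 3) : ∀ᵐ x, x ∈ U → w x j = 0 := by
    refine hU.ae_eq_zero_of_integral_contDiff_smul_eq_zero (f := fun x => w x j) ?_ ?_
    · intro x hx
      obtain ⟨s, hs, hi⟩ := hw x hx
      exact ⟨s, hs, (EuclideanSpace.proj j : Vec →L[ℝ] ℝ).integrable_comp hi⟩
    · intro g hg hc hs
      have ht : IsTest U g := ⟨hg, hc, hs⟩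
      -- Test fields along a fixed coordinate vector reduce the claim to the scalar lemma for each
      -- component.
      have ht' : IsTest U fun x => g x • (EuclideanSpace.single j 1 : Vec) :=
        ht.of_support (hg.smul contDiff_const) fun x hx => by simp [hx]
      rw [← h _ ht']
      refine integral_congr_ae (Eventually.of_forall fun x => ?_)
      simp [inner_smul_right, EuclideanSpace.inner_single_right]
  filter_upwards [hj 0, hj 1, hj 2] with x h0 h1 h2 hx
  ext i
  fin_cases i
  · exact h0 hx
  · exact h1 hx
  · exact h2 hx

lemma memLp_locallyIntegrableOn {w : VField d} (hw : MemLp w 2 (volume.restrict Ω))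
    {U : Set (Pt d)} (hU : U ⊆ Ω) : LocallyIntegrableOn w U :=
  (locallyIntegrableOn_of_locallyIntegrable_restrict
    (hw.locallyIntegrable (by norm_num))).mono_set hU

/-- The curl in `H₀(curl, Ω)` is unique. -/
lemma HasCurl0.unique (hΩ : IsOpen Ω) {u w u' w' : VField d} (hu : HasCurl0 Ω u w)
    (hu' : HasCurl0 Ω u' w') (h : u =ᵐ[volume.restrict Ω] u') :
    w =ᵐ[volume.restrict Ω] w' := by
  have hm : MemLp (fun x => (1 : ℝ) • w x + (-1 : ℝ) • w' x) 2 (volume.restrict Ω) :=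
    (hu.2.1.const_smul (1 : ℝ)).add (hu'.2.1.const_smul (-1 : ℝ))
  have key := ae_eq_zero_of_forall_isTest hΩ (memLp_locallyIntegrableOn hm subset_rfl)
    fun ψ hψ => by
      rw [← hψ.setIntegral_inner, ip_linearComb_left hu.2.1 hu'.2.1 hψ.memLp,
        HasCurl0.ip_test hu hψ, HasCurl0.ip_test hu' hψ, ip_congr h (ae_eq_refl _)]
      ring
  rw [EventuallyEq, ae_restrict_iff' hΩ.measurableSet]
  filter_upwards [key] with x hx hxΩ
  have := hx hxΩ
  simpa [← sub_eq_add_neg, sub_eq_zero] using this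

lemma curl_congr {u v : VField d} {x : Pt d} (h : u =ᶠ[𝓝 x] v) : curl u x = curl v x := by
  simp only [curl_eq, h.fderiv_eq]

/-- For an elementwise smooth field in `H₀(curl, Ω)` the elementwise curl is the weak one. -/
lemma HasCurl0.ae_eq_curl (hT : IsTriangulation T Ω) {u w : VField d} (hu : HasCurl0 Ω u w)
    (hs : ∀ K ∈ elems T, ∃ p : VField d, ContDiff ℝ ∞ p ∧ Set.EqOn u p (interior (hull K))) :
    w =ᵐ[volume.restrict Ω] curl u := by
  refine hT.ae_restrict fun K hK => ?_
  obtain ⟨p, hp, hup⟩ := hs K hK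
  have hKΩ := hT.interior_hull_subset hK
  -- Test fields supported inside one element see `u` only as the smooth field `p`, so weak
  -- integration by parts for `u` and classical integration by parts for `p` give the same value.
  -- Traces on faces never enter.
  have key := ae_eq_zero_of_forall_isTest (isOpen_interior (s := hull K))
    (w := fun x => w x - curl p x)
    ((memLp_locallyIntegrableOn hu.2.1 hKΩ).sub
      ((contDiff_curl hp).continuous.locallyIntegrable.locallyIntegrableOn _))
    fun ψ hψ => by
      have hψΩ := hψ.mono hKΩ
      have h1 : Integrable fun x => ⟪w x, ψ x⟫_ℝ := by
        rw [← integrableOn_iff_integrable_of_support_subset (s := Ω)]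
        · exact memLp_integrable_inner hu.2.1 hψΩ.memLp
        · intro x hx
          by_contra h
          exact hx (by simp [hψΩ.eq_zero h])
      have h2 : IsTest (interior (hull K)) fun x => ⟪curl p x, ψ x⟫_ℝ :=
        hψ.of_support ((contDiff_curl hp).inner ℝ hψ.1) fun x hx => by simp [hx]
      simp only [inner_sub_left]
      rw [integral_sub h1 h2.integrable, ← hψΩ.setIntegral_inner, HasCurl0.ip_test hu hψΩ,
        (isTest_curl hψΩ).setIntegral_inner, sub_eq_zero]
      simp only [real_inner_comm (ψ _), real_inner_comm (curl ψ _)]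
      rw [← hψ.integral_inner_curl hp]
      refine integral_congr_ae (Eventually.of_forall fun x => ?_)
      by_cases hx : x ∈ interior (hull K)
      · simp only [hup hx]
      · simp [(isTest_curl hψ).eq_zero hx]
  filter_upwards [key] with x hx hxK
  rw [sub_eq_zero.1 (hx hxK)]
  exact curl_congr (((isOpen_interior.mem_nhds hxK |> fun h => hup.eventuallyEq_of_mem h)).symm)

/-- The linear map that sends the derivative of a scalar function to its gradient in `ℝ³`. -/
noncomputable def gradMap (d : ℕ) : (Pt d →L[ℝ] ℝ) →L[ℝ] Vec :=
  LinearMap.toContinuousLinearMap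
    { toFun := fun M => !₂[M (coordVec d 0), M (coordVec d 1), M (coordVec d 2)]
      map_add' := fun M N => by
        ext i; fin_cases i <;> simp
      map_smul' := fun c M => by
        ext i; fin_cases i <;> simp }

lemma adv_eq_inner (u : VField d) (f : Pt d → ℝ) (x : Pt d) :
    adv u f x = ⟪u x, gradMap d (fderiv ℝ f x)⟫_ℝ := by
  rw [adv_apply, inner_vec]
  simp only [pd_eq]
  rfl

/-! ### Divergence-free fields -/

lemma IsDivFree_of_inClosure {u : VField d} (hu : InClosure Ω dv u 0) : IsDivFree Ω u := by
  intro f hf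
  obtain ⟨hu1, hw, φ, hφ, h1, h2⟩ := hu
  have hg : IsTest Ω fun x => gradMap d (fderiv ℝ f x) := (isTest_fderiv hf).comp_clm _
  have l1 := tendsto_ip (fun n => (hφ n).memLp) hu1 hg.memLp h1
  have l2 := tendsto_ip (fun n => (isTest_dv (hφ n)).memLp) hw hf.memLp h2
  have e (n : ℕ) : ip Ω (φ n) (fun x => gradMap d (fderiv ℝ f x)) = -ip Ω (dv (φ n)) f := by
    rw [hg.setIntegral_inner]
    simp only [← adv_eq_inner]
    rw [(hφ n).integral_adv hf, ip]
    congr 1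
    refine (setIntegral_eq_integral_of_forall_compl_eq_zero fun x hx => ?_).symm
    simp [hf.eq_zero hx]
  simp only [e] at l1
  have := tendsto_nhds_unique l1 l2.neg
  simp only [adv_eq_inner]
  simpa [ip] using this

/-- The curls of the approximating test fields are divergence-free test fields converging to `w`.
Hence `w` also inherits the boundary condition of H₀(div), not only zero divergence. -/
lemma HasCurl0.inClosure_dv {u w : VField d} (hu : HasCurl0 Ω u w) : InClosure Ω dv w 0 := by
  obtain ⟨-, hw, φ, hφ, -, h2⟩ := hu
  refine ⟨hw, MemLp.zero, fun n => curl (φ n), fun n => isTest_curl (hφ n), h2, ?_⟩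
  have e (n : ℕ) : dv (curl (φ n)) = 0 := funext (dv_curl (hφ n).1)
  simp [e]

/-- Equality is required only almost everywhere, since Faraday's law is available only in that form.
-/
lemma IsDivFree.linearComb {u v : VField d} (hu : IsDivFree Ω u) (hv : IsDivFree Ω v)
    (hu' : MemLp u 2 (volume.restrict Ω)) (hv' : MemLp v 2 (volume.restrict Ω)) {a b : ℝ}
    {w : VField d} (hw : w =ᵐ[volume.restrict Ω] fun x => a • u x + b • v x) :
    IsDivFree Ω w := by
  intro f hf
  have hg : IsTest Ω fun x => gradMap d (fderiv ℝ f x) := (isTest_fderiv hf).comp_clm _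
  have h1 := hu f hf
  have h2 := hv f hf
  simp only [adv_eq_inner] at h1 h2 ⊢
  change ip Ω w _ = 0
  rw [ip_congr hw (ae_eq_refl _), ip_linearComb_left hu' hv' hg.memLp]
  change a * (∫ x in Ω, _) + b * (∫ x in Ω, _) = 0
  rw [h1, h2]; ring

/-! ### Polynomial fields -/

section Poly

open MvPolynomial

lemma totalDegree_linearComb_le {σ : Type*} {p q : MvPolynomial σ ℝ} {n : ℕ}
    (hp : p.totalDegree ≤ n) (hq : q.totalDegree ≤ n) (a b : ℝ) :
    (C a * p + C b * q).totalDegree ≤ n := by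
  refine (totalDegree_add _ _).trans (max_le ?_ ?_)
  · exact (totalDegree_mul _ _).trans (by simpa using hp)
  · exact (totalDegree_mul _ _).trans (by simpa using hq)

lemma totalDegree_pderiv_le {σ : Type*} (i : σ) (p : MvPolynomial σ ℝ) :
    (pderiv i p).totalDegree ≤ p.totalDegree - 1 := by
  classical
  conv_lhs => rw [p.as_sum, map_sum]
  refine totalDegree_finsetSum_le fun s hs => ?_
  rw [pderiv_monomial]
  by_cases h : s i = 0
  · simp [h]
  refine (totalDegree_monomial_le _ _).trans ?_
  have h1 : s.degree ≤ p.totalDegree := le_totalDegree hs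
  have h2 : (s - Finsupp.single i 1) + Finsupp.single i 1 = s :=
    tsub_add_cancel_of_le (by simpa using Nat.one_le_iff_ne_zero.2 h)
  have h3 : (s - Finsupp.single i 1).degree + 1 = s.degree := by
    conv_rhs => rw [← h2]
    simp
  change (s - Finsupp.single i 1).degree ≤ _
  omega

/-- The partial derivative of a polynomial, which is zero if `i ≥ d`. -/
noncomputable def pdPoly (i : Fin 3) (p : MvPolynomial (Fin d) ℝ) : MvPolynomial (Fin d) ℝ :=
  if h : (i : ℕ) < d then pderiv ⟨i, h⟩ p else 0

/-- The coordinates of the inclusion `ℝ^d → ℝ³`. -/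
noncomputable def embPoly (d : ℕ) (i : Fin 3) : MvPolynomial (Fin d) ℝ :=
  if h : (i : ℕ) < d then X ⟨i, h⟩ else 0

lemma totalDegree_pdPoly_le (i : Fin 3) (p : MvPolynomial (Fin d) ℝ) :
    (pdPoly i p).totalDegree ≤ p.totalDegree - 1 := by
  unfold pdPoly
  split_ifs
  · exact totalDegree_pderiv_le _ _
  · simp

lemma totalDegree_embPoly_le (i : Fin 3) : (embPoly d i).totalDegree ≤ 1 := by
  unfold embPoly
  split_ifs <;> simp

lemma totalDegree_embPoly_mul_pdPoly_le (i j : Fin 3) (p : MvPolynomial (Fin d) ℝ) :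
    (embPoly d i * pdPoly j p).totalDegree ≤ p.totalDegree := by
  -- The bound `totalDegree - 1` is truncated at degree 0 and would give only 1 for the product;
  -- there the derivative vanishes instead.
  rcases Nat.eq_zero_or_pos p.totalDegree with h | h
  · rw [totalDegree_eq_zero_iff_eq_C.1 h]
    simp [pdPoly]
  · have h1 := totalDegree_mul (embPoly d i) (pdPoly j p)
    have h2 := totalDegree_embPoly_le (d := d) i
    have h3 := totalDegree_pdPoly_le j p
    omega

lemma pdPoly_add (i : Fin 3) (p q : MvPolynomial (Fin d) ℝ) :
    pdPoly i (p + q) = pdPoly i p + pdPoly i q := by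
  unfold pdPoly; split_ifs <;> simp

lemma pdPoly_sub (i : Fin 3) (p q : MvPolynomial (Fin d) ℝ) :
    pdPoly i (p - q) = pdPoly i p - pdPoly i q := by
  unfold pdPoly; split_ifs <;> simp

lemma pdPoly_mul (i : Fin 3) (p q : MvPolynomial (Fin d) ℝ) :
    pdPoly i (p * q) = p * pdPoly i q + q * pdPoly i p := by
  unfold pdPoly; split_ifs <;> simp [Derivation.leibniz]

/-- The function given by a polynomial. -/
noncomputable def polyFun (p : MvPolynomial (Fin d) ℝ) (x : Pt d) : ℝ := eval (fun j => x j) p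

lemma contDiff_polyFun (p : MvPolynomial (Fin d) ℝ) : ContDiff ℝ ∞ (polyFun p) := by
  have h : AnalyticOnNhd ℝ (fun x : Fin d → ℝ => eval x p) Set.univ :=
    AnalyticOnNhd.eval_mvPolynomial p
  have h2 : ContDiff ℝ ∞ fun x : Fin d → ℝ => eval x p := h.contDiff
  exact h2.comp (PiLp.contDiff_ofLp (𝕜 := ℝ))

lemma pd_polyFun (i : Fin 3) (p : MvPolynomial (Fin d) ℝ) (x : Pt d) :
    pd i (polyFun p) x = polyFun (pdPoly i p) x := by
  have hd (p : MvPolynomial (Fin d) ℝ) : DifferentiableAt ℝ (polyFun p) x :=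
    (contDiff_polyFun p).differentiable (by simp) x
  induction p using MvPolynomial.induction_on with
  | C a =>
    have e : polyFun (C a) = fun _ : Pt d => a := by funext y; simp [polyFun]
    rw [e, pd_const]
    simp [polyFun, pdPoly]
  | add p q hp hq =>
    have e : polyFun (p + q) = fun y : Pt d => polyFun p y + polyFun q y := by
      funext y; simp [polyFun]
    rw [e, pd_add _ (hd p) (hd q), hp, hq, pdPoly_add]
    simp [polyFun]
  | mul_X p j hp =>
    have e : polyFun (p * X j) = fun y : Pt d => polyFun p y * polyFun (X j) y := by
      funext y; simp [polyFun]
    have e2 : pd i (polyFun (X j)) x = polyFun (pdPoly i (X j)) x := by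
      have h := (EuclideanSpace.proj j : Pt d →L[ℝ] ℝ).fderiv (x := x)
      have e3 : polyFun (X j) = (EuclideanSpace.proj j : Pt d →L[ℝ] ℝ) := by
        funext y; simp [polyFun]
      rw [pd_eq, e3, h]
      unfold coordVec pdPoly
      split_ifs with hi
      · simp [polyFun, pderiv_X, Pi.single_apply, eq_comm, apply_ite]
      · simp [polyFun]
    rw [e, pd_mul _ (hd p) (hd (X j)), hp, e2, pdPoly_mul]
    simp [polyFun]

namespace VPoly

lemma toVField_apply (p : VPoly d) (x : Pt d) (i : Fin 3) : p.toVField x i = polyFun (p i) x := rfl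

lemma contDiff_toVField (p : VPoly d) : ContDiff ℝ ∞ p.toVField :=
  contDiff_euclidean.2 fun i => contDiff_polyFun (p i)

/-- The linear combination of two polynomial fields. -/
noncomputable def comb (a b : ℝ) (p q : VPoly d) : VPoly d := fun i => C a * p i + C b * q i

lemma toVField_comb (a b : ℝ) (p q : VPoly d) (x : Pt d) :
    (comb a b p q).toVField x = a • p.toVField x + b • q.toVField x := by
  ext i
  simp [toVField, comb]

lemma DegLE.comb {p q : VPoly d} {n : ℕ} (hp : p.DegLE n) (hq : q.DegLE n) (a b : ℝ) :
    (comb a b p q).DegLE n := fun i => totalDegree_linearComb_le (hp i) (hq i) a b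

lemma InPlane.comb {p q : VPoly d} (hp : p.InPlane) (hq : q.InPlane) (a b : ℝ) :
    (comb a b p q).InPlane := fun h => by simp [VPoly.comb, hp h, hq h]

lemma Axial.comb {p q : VPoly d} (hp : p.Axial) (hq : q.Axial) (a b : ℝ) :
    (comb a b p q).Axial := fun h => by simp [VPoly.comb, hp h, hq h]

/-- The curl of a polynomial field. -/
noncomputable def curlPoly (p : VPoly d) : VPoly d :=
  ![pdPoly 1 (p 2) - pdPoly 2 (p 1), pdPoly 2 (p 0) - pdPoly 0 (p 2),
    pdPoly 0 (p 1) - pdPoly 1 (p 0)]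

/-- The cross product of the position vector and a polynomial field. -/
noncomputable def crossPos (q : VPoly d) : VPoly d :=
  ![embPoly d 1 * q 2 - embPoly d 2 * q 1, embPoly d 2 * q 0 - embPoly d 0 * q 2,
    embPoly d 0 * q 1 - embPoly d 1 * q 0]

lemma curl_toVField (p : VPoly d) (x : Pt d) : curl p.toVField x = (curlPoly p).toVField x := by
  have hd := p.contDiff_toVField.differentiable (by simp) x
  ext i
  fin_cases i
  · simp only [Fin.zero_eta, curl_apply_zero hd, toVField_apply]
    simp only [fun i => show (fun y => polyFun (p i) y) = polyFun (p i) from rfl, pd_polyFun]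
    simp [curlPoly, polyFun]
  · simp only [Fin.mk_one, curl_apply_one hd, toVField_apply]
    simp only [fun i => show (fun y => polyFun (p i) y) = polyFun (p i) from rfl, pd_polyFun]
    simp [curlPoly, polyFun]
  · simp only [Fin.reduceFinMk, curl_apply_two hd, toVField_apply]
    simp only [fun i => show (fun y => polyFun (p i) y) = polyFun (p i) from rfl, pd_polyFun]
    simp [curlPoly, polyFun]

end VPoly

lemma polyFun_embPoly (i : Fin 3) (x : Pt d) : polyFun (embPoly d i) x = emb x i := by
  unfold polyFun embPoly emb
  split_ifs with h <;> simp [h]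

lemma VPoly.crossPos_toVField (q : VPoly d) (x : Pt d) :
    (crossPos q).toVField x = cross (emb x) (q.toVField x) := by
  ext i
  fin_cases i
  · simp only [Fin.zero_eta, cross_apply_zero, toVField_apply, ← polyFun_embPoly]
    simp [crossPos, polyFun]
  · simp only [Fin.mk_one, cross_apply_one, toVField_apply, ← polyFun_embPoly]
    simp [crossPos, polyFun]
  · simp only [Fin.reduceFinMk, cross_apply_two, toVField_apply, ← polyFun_embPoly]
    simp [crossPos, polyFun]

lemma VPoly.DegLE.mono {p : VPoly d} {m n : ℕ} (hp : p.DegLE m) (h : m ≤ n) : p.DegLE n :=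
  fun i => (hp i).trans h

lemma VPoly.DegLE.curlPoly {p : VPoly d} {n : ℕ} (hp : p.DegLE n) :
    (VPoly.curlPoly p).DegLE (n - 1) := by
  have h (i j : Fin 3) : (pdPoly i (p j)).totalDegree ≤ n - 1 := by
    have := totalDegree_pdPoly_le i (p j)
    have := hp j
    omega
  have h2 (i j k l : Fin 3) : (pdPoly i (p j) - pdPoly k (p l)).totalDegree ≤ n - 1 :=
    (totalDegree_sub _ _).trans (max_le (h _ _) (h _ _))
  intro i
  fin_cases i <;> exact h2 _ _ _ _

lemma VPoly.DegLE.crossPos {p : VPoly d} {n : ℕ} (hp : p.DegLE n) :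
    (VPoly.crossPos p).DegLE (n + 1) := by
  have h (i j : Fin 3) : (embPoly d i * p j).totalDegree ≤ n + 1 := by
    have := totalDegree_mul (embPoly d i) (p j)
    have := totalDegree_embPoly_le (d := d) i
    have := hp j
    omega
  have h2 (i j k l : Fin 3) : (embPoly d i * p j - embPoly d k * p l).totalDegree ≤ n + 1 :=
    (totalDegree_sub _ _).trans (max_le (h _ _) (h _ _))
  intro i
  fin_cases i <;> exact h2 _ _ _ _

/-- `curl (x × q) = -2 q - (x · ∇) q + (div q) x` in three dimensions. -/
lemma VPoly.curlPoly_crossPos (q : VPoly 3) (i : Fin 3) :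
    VPoly.curlPoly (VPoly.crossPos q) i =
      (-2 * q i - (embPoly 3 0 * pdPoly 0 (q i) + embPoly 3 1 * pdPoly 1 (q i)
        + embPoly 3 2 * pdPoly 2 (q i)))
      + (pdPoly 0 (q 0) + pdPoly 1 (q 1) + pdPoly 2 (q 2)) * embPoly 3 i := by
  have e (i j : Fin 3) : pdPoly i (embPoly 3 j) = if i = j then 1 else 0 := by
    have hi : (i : ℕ) < 3 := i.2
    have hj : (j : ℕ) < 3 := j.2
    simp only [pdPoly, embPoly, hi, hj, dif_pos, pderiv_X, Pi.single_apply, Fin.eta]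
    simp [eq_comm]
  fin_cases i <;>
  · simp [VPoly.curlPoly, VPoly.crossPos, pdPoly_sub, pdPoly_mul, e]
    ring

end Poly

/-- The field is elementwise polynomial of degree at most `n`. -/
def PwPoly (T : Geometry.SimplicialComplex ℝ (Pt d)) (n : ℕ) (u : VField d) : Prop :=
  ∀ K ∈ elems T, ∃ p : VPoly d, p.DegLE n ∧ Set.EqOn u p.toVField (interior (hull K))

lemma PwPoly.pwCont {n : ℕ} {u : VField d} (hu : PwPoly T n u) : PwCont T u := fun K hK =>
  let ⟨p, _, hp⟩ := hu K hK
  ⟨_, p.contDiff_toVField.continuous.continuousOn, hp⟩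

lemma PwPoly.smooth {n : ℕ} {u : VField d} (hu : PwPoly T n u) :
    ∀ K ∈ elems T, ∃ p : VField d, ContDiff ℝ ∞ p ∧ Set.EqOn u p (interior (hull K)) :=
  fun K hK =>
  let ⟨p, _, hp⟩ := hu K hK
  ⟨_, p.contDiff_toVField, hp⟩

/-! ### The finite element spaces -/

section Spaces

variable {r s : ℕ}

lemma pwPoly_of_mem_CG {u : VField d} (hu : u ∈ CG Ω T r) : PwPoly T (r + 1) u := fun K hK =>
  let ⟨p, _, hd, hp⟩ := hu.2 K hK
  ⟨p, hd, hp⟩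

lemma pwPoly_of_mem_RT {u : VField d} (hu : u ∈ RT Ω T r) : PwPoly T (r + 1) u := fun K hK => by
  obtain ⟨p, q, -, hd, hq, hp⟩ := hu.2 K hK
  refine ⟨fun i => p i + q * embPoly d i, fun i => ?_, fun x hx => ?_⟩
  · refine (MvPolynomial.totalDegree_add _ _).trans (max_le ((hd i).trans (by omega)) ?_)
    have := MvPolynomial.totalDegree_mul q (embPoly d i)
    have := totalDegree_embPoly_le (d := d) i
    omega
  · rw [hp x hx]
    ext i
    simp only [PiLp.add_apply, PiLp.smul_apply, ← polyFun_embPoly, VPoly.toVField_apply]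
    simp [polyFun]

lemma pwPoly_of_mem_NED {u : VField d} (hu : u ∈ NED Ω T r) : PwPoly T (r + 1) u :=
  fun K hK => by
  obtain ⟨p, q, -, -, hd, hq, hp⟩ := hu.2 K hK
  refine ⟨VPoly.comb 1 1 p (VPoly.crossPos q), (hd.mono (by omega)).comb hq.crossPos 1 1,
    fun x hx => ?_⟩
  rw [hp x hx, VPoly.toVField_comb, VPoly.crossPos_toVField, one_smul, one_smul]

lemma pwPoly_of_mem_AUX {u : VField d} (hu : u ∈ AUX Ω T r) : PwPoly T (r + 1) u := by
  unfold AUX at hu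
  split_ifs at hu
  · exact fun K hK =>
      let ⟨p, _, hd, hp⟩ := hu.2 K hK
      ⟨p, hd, hp⟩
  · exact pwPoly_of_mem_NED hu

lemma pwCont_of_mem_DG {f : Pt d → ℝ} (hf : f ∈ DG T s) : PwCont T f := fun K hK =>
  let ⟨p, _, hp⟩ := hf K hK
  ⟨polyFun p, (contDiff_polyFun p).continuous.continuousOn, hp⟩

lemma memH0curl_of_mem_AUX {u : VField d} (hu : u ∈ AUX Ω T r) : MemH0curl Ω u := by
  unfold AUX at hu
  split_ifs at hu
  · exact hu.1.memH0curl
  · exact hu.1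

lemma hasCurl0_of_mem_AUX (hT : IsTriangulation T Ω) {u : VField d} (hu : u ∈ AUX Ω T r) :
    HasCurl0 Ω u (curl u) := by
  obtain ⟨w, hw⟩ := memH0curl_of_mem_AUX hu
  exact InClosure.congr_right hw (HasCurl0.ae_eq_curl hT hw (pwPoly_of_mem_AUX hu).smooth)

/-- This is the discrete de Rham property that makes curls of `J` and `E` admissible test fields.
Conformity and the boundary condition come from `HasCurl0.inClosure_dv`; the rest is a degree count
on each element. -/
lemma curl_mem_RT (hd : d = 2 ∨ d = 3) (hT : IsTriangulation T Ω) {u : VField d}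
    (hu : u ∈ AUX Ω T r) : curl u ∈ RT Ω T r := by
  refine ⟨⟨0, HasCurl0.inClosure_dv (hasCurl0_of_mem_AUX hT hu)⟩, fun K hK => ?_⟩
  have hcurl {p : VPoly d} (hp : Set.EqOn u p.toVField (interior (hull K))) {x : Pt d}
      (hx : x ∈ interior (hull K)) : curl u x = (VPoly.curlPoly p).toVField x := by
    rw [← VPoly.curl_toVField]
    exact curl_congr (hp.eventuallyEq_of_mem (isOpen_interior.mem_nhds hx))
  unfold AUX at hu
  split_ifs at hu with h2
  · obtain ⟨p, hax, hdeg, hp⟩ := hu.2 K hK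
    -- Planar case: the curl of an axial field lies in the plane and its degree drops from `r + 1`
    -- to `r`, so no radial part is needed.
    refine ⟨VPoly.curlPoly p, 0, fun _ => ?_, by simpa using hdeg.curlPoly, by simp,
      fun x hx => ?_⟩
    · simp [VPoly.curlPoly, hax h2, pdPoly]
    · rw [hcurl hp hx]; simp
  · obtain rfl : d = 3 := by omega
    obtain ⟨p, q, -, -, hdp, hdq, hp⟩ := hu.2 K hK
    have hp' : Set.EqOn u (VPoly.comb 1 1 p (VPoly.crossPos q)).toVField (interior (hull K)) :=
      fun x hx => by
        rw [hp x hx, VPoly.toVField_comb, VPoly.crossPos_toVField, one_smul, one_smul]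
    -- By `VPoly.curlPoly_crossPos` the only part of the curl that may have degree `r + 1` is `(div
    -- q) x`; it is taken as the radial part. The term `(x · ∇) q` keeps degree at most `r`.
    refine ⟨fun i => VPoly.curlPoly p i + (-2 * q i - (embPoly 3 0 * pdPoly 0 (q i)
        + embPoly 3 1 * pdPoly 1 (q i) + embPoly 3 2 * pdPoly 2 (q i))),
      pdPoly 0 (q 0) + pdPoly 1 (q 1) + pdPoly 2 (q 2), fun h => absurd h (by norm_num),
      fun i => ?_, ?_, fun x hx => ?_⟩
    · have h1 (j : Fin 3) := (totalDegree_embPoly_mul_pdPoly_le j j (q i)).trans (hdq i)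
      refine (MvPolynomial.totalDegree_add _ _).trans (max_le ((hdp.curlPoly i).trans (by omega)) ?_)
      refine (MvPolynomial.totalDegree_sub _ _).trans (max_le ?_ ?_)
      · have e : (-2 : MvPolynomial (Fin 3) ℝ) = MvPolynomial.C (-2) := by
          rw [map_neg, map_ofNat]
        rw [e]
        exact (MvPolynomial.totalDegree_mul _ _).trans (by simpa using hdq i)
      · exact (MvPolynomial.totalDegree_add _ _).trans (max_le
          ((MvPolynomial.totalDegree_add _ _).trans (max_le (h1 0) (h1 1))) (h1 2))
    · have h1 (j : Fin 3) : (pdPoly j (q j)).totalDegree ≤ r :=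
        (totalDegree_pdPoly_le j (q j)).trans ((Nat.sub_le _ _).trans (hdq j))
      exact (MvPolynomial.totalDegree_add _ _).trans (max_le
          ((MvPolynomial.totalDegree_add _ _).trans (max_le (h1 0) (h1 1))) (h1 2))
    · rw [hcurl hp' hx]
      have e : VPoly.curlPoly (VPoly.comb 1 1 p (VPoly.crossPos q)) =
          fun i => VPoly.curlPoly p i + VPoly.curlPoly (VPoly.crossPos q) i := by
        funext i
        fin_cases i <;>
        · simp [VPoly.curlPoly, VPoly.comb, pdPoly_add]
          ring
      rw [e]
      ext i
      simp only [VPoly.curlPoly_crossPos, PiLp.add_apply, PiLp.smul_apply, ← polyFun_embPoly,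
        VPoly.toVField_apply]
      simp only [polyFun, map_add, map_mul, smul_eq_mul]
      ring

/-- The set is closed under linear combinations. -/
def IsLinear {F : Type*} [AddCommGroup F] [Module ℝ F] (V : Set (Pt d → F)) : Prop :=
  ∀ u ∈ V, ∀ v ∈ V, ∀ a b : ℝ, (fun x => a • u x + b • v x) ∈ V

lemma isLinear_DG : IsLinear (DG T s) := fun u hu v hv a b K hK => by
  obtain ⟨p, hp, hup⟩ := hu K hK
  obtain ⟨q, hq, hvq⟩ := hv K hK
  exact ⟨_, totalDegree_linearComb_le hp hq a b, fun x hx => by simp [hup x hx, hvq x hx]⟩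

lemma isLinear_CG : IsLinear (CG Ω T r) := fun u hu v hv a b => by
  refine ⟨hu.1.linearComb hv.1 a b, fun K hK => ?_⟩
  obtain ⟨p, hp, hp', hup⟩ := hu.2 K hK
  obtain ⟨q, hq, hq', hvq⟩ := hv.2 K hK
  exact ⟨_, hp.comb hq a b, hp'.comb hq' a b, fun x hx => by
    simp only [VPoly.toVField_comb, hup x hx, hvq x hx]⟩

lemma isLinear_RT : IsLinear (RT Ω T r) := fun u hu v hv a b => by
  refine ⟨hu.1.linearComb hv.1 a b, fun K hK => ?_⟩
  obtain ⟨p, p₁, hp, hp', hp₁, hup⟩ := hu.2 K hK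
  obtain ⟨q, q₁, hq, hq', hq₁, hvq⟩ := hv.2 K hK
  refine ⟨_, _, hp.comb hq a b, hp'.comb hq' a b, totalDegree_linearComb_le hp₁ hq₁ a b,
    fun x hx => ?_⟩
  simp only [VPoly.toVField_comb, hup x hx, hvq x hx, map_add, map_mul, MvPolynomial.eval_C]
  module

lemma isLinear_NED : IsLinear (NED Ω T r) := fun u hu v hv a b => by
  refine ⟨hu.1.linearComb hv.1 a b, fun K hK => ?_⟩
  obtain ⟨p, p₁, hp, hp₁, hp', hp₁', hup⟩ := hu.2 K hK
  obtain ⟨q, q₁, hq, hq₁, hq', hq₁', hvq⟩ := hv.2 K hK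
  refine ⟨_, _, hp.comb hq a b, hp₁.comb hq₁ a b, hp'.comb hq' a b, hp₁'.comb hq₁' a b,
    fun x hx => ?_⟩
  simp only [VPoly.toVField_comb, hup x hx, hvq x hx]
  have e : cross (emb x) (a • p₁.toVField x + b • q₁.toVField x)
      = a • cross (emb x) (p₁.toVField x) + b • cross (emb x) (q₁.toVField x) := by
    simp [cross]
  rw [e]
  module

lemma isLinear_AUX : IsLinear (AUX Ω T r) := by
  unfold AUX
  split_ifs with h
  · intro u hu v hv a b
    refine ⟨hu.1.linearComb hv.1 a b, fun K hK => ?_⟩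
    obtain ⟨p, hp, hp', hup⟩ := hu.2 K hK
    obtain ⟨q, hq, hq', hvq⟩ := hv.2 K hK
    exact ⟨_, hp.comb hq a b, hp'.comb hq' a b, fun x hx => by
      simp only [VPoly.toVField_comb, hup x hx, hvq x hx]⟩
  · exact isLinear_NED

lemma IsLinear.mid {F : Type*} [AddCommGroup F] [Module ℝ F] {V : Set (Pt d → F)}
    (hV : IsLinear V) {u v : Pt d → F} (hu : u ∈ V) (hv : v ∈ V) : mid u v ∈ V := by
  have e : CompressibleMHD.mid u v = fun x => (1 / 2 : ℝ) • u x + (1 / 2 : ℝ) • v x := by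
    funext x; simp [CompressibleMHD.mid]
  rw [e]; exact hV u hu v hv _ _

lemma IsLinear.dt {F : Type*} [AddCommGroup F] [Module ℝ F] {V : Set (Pt d → F)}
    (hV : IsLinear V) {u v : Pt d → F} (hu : u ∈ V) (hv : v ∈ V) (Δt : ℝ) :
    dt Δt u v ∈ V := by
  have e : CompressibleMHD.dt Δt u v = fun x => (-(1 / Δt)) • u x + (1 / Δt) • v x := by
    funext x; simp only [CompressibleMHD.dt]; module
  rw [e]; exact hV u hu v hv _ _

lemma isLinear_velSpace (m : Regime d) : IsLinear (m.velSpace Ω T r) := by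
  cases m
  · exact isLinear_CG
  · exact isLinear_RT

lemma pwPoly_of_mem_velSpace {m : Regime d} {u : VField d} (hu : u ∈ m.velSpace Ω T r) :
    PwPoly T (r + 1) u := by
  cases m
  · exact pwPoly_of_mem_CG hu
  · exact pwPoly_of_mem_RT hu

end Spaces

/-! ### Riesz representation in finite element spaces -/

section Riesz

variable {F : Type*} [AddCommGroup F] [Module ℝ F]

/-- The subspace given by a nonempty set that is closed under linear combinations. -/
def IsLinear.toSubmodule {V : Set (Pt d → F)} (hV : IsLinear V) (hne : V.Nonempty) :
    Submodule ℝ (Pt d → F) where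
  carrier := V
  add_mem' {u v} hu hv := by
    have h := hV u hu v hv 1 1
    simp only [one_smul] at h
    exact h
  zero_mem' := by
    obtain ⟨u, hu⟩ := hne
    have h := hV u hu u hu 0 0
    simp only [zero_smul, add_zero] at h
    exact h
  smul_mem' c u hu := by
    have h := hV u hu u hu c 0
    simp only [zero_smul, add_zero] at h
    exact h

end Riesz

lemma PwPoly.memLp (hT : IsTriangulation T Ω) {n : ℕ} {u : VField d} (hu : PwPoly T n u) :
    MemLp u 2 (volume.restrict Ω) := hu.pwCont.memLp hT

lemma PwCont.inner {u v : VField d} (hu : PwCont T u) (hv : PwCont T v) :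
    PwCont T fun x => ⟪u x, v x⟫_ℝ :=
  hu.comp₂ hv (φ := fun a b => ⟪a, b⟫_ℝ) (by fun_prop)

lemma pwCont_toVField (p : VPoly d) : PwCont T p.toVField := fun _ _ =>
  ⟨_, p.contDiff_toVField.continuous.continuousOn, fun _ _ => rfl⟩

/-- A linear functional on a space of elementwise polynomial fields that vanishes on null fields
is represented by an element of the space. -/
theorem exists_ip_eq (hT : IsTriangulation T Ω) {V : Set (VField d)} (hV : IsLinear V)
    (hne : V.Nonempty) {n : ℕ} (hP : ∀ u ∈ V, PwPoly T n u) (ℓ : VField d → ℝ)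
    (hℓ : ∀ u ∈ V, ∀ v ∈ V, ∀ a b : ℝ, ℓ (fun x => a • u x + b • v x) = a * ℓ u + b * ℓ v)
    (h0 : ∀ u ∈ V, (∀ᵐ x ∂volume.restrict Ω, u x = 0) → ℓ u = 0) :
    ∃ P ∈ V, ∀ C ∈ V, ip Ω P C = ℓ C := by
  classical
  let S := hV.toSubmodule hne
  have hS (u : S) : MemLp u.1 2 (volume.restrict Ω) := (hP u.1 u.2).memLp hT
  -- `S` itself may be infinite-dimensional, because values outside the open elements are
  -- unconstrained by the polynomial condition. The finite-dimensional object is the range of `Φ` in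
  -- the dual of `S`.
  let Φ : S →ₗ[ℝ] Module.Dual ℝ S := LinearMap.mk₂ ℝ (fun u v => ip Ω u.1 v.1)
    (fun u v w => by
      have h := ip_linearComb_left (hS u) (hS v) (hS w) 1 1
      simp only [one_smul, one_mul] at h
      exact h)
    (fun c u v => by
      have h := ip_linearComb_left (hS u) (hS u) (hS v) c 0
      simp only [zero_smul, zero_mul, add_zero] at h
      exact h)
    (fun u v w => by
      have h := ip_linearComb_right (hS v) (hS w) (hS u) 1 1
      simp only [one_smul, one_mul] at h
      exact h)
    (fun c u v => by
      have h := ip_linearComb_right (hS v) (hS v) (hS u) c 0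
      simp only [zero_smul, zero_mul, add_zero] at h
      exact h)
  let ι := {K // K ∈ hT.finite_elems.toFinset}
  let W := ι → Fin 3 → MvPolynomial.restrictTotalDegree (Fin d) ℝ n
  let tof (p : W) (K : ι) : VPoly d := fun i => (p K i).1
  have hint (p : VPoly d) (v : S) (K : ι) :
      IntegrableOn (fun x => ⟪p.toVField x, v.1 x⟫_ℝ) (interior (hull K.1)) :=
    (((pwCont_toVField p).inner (hP v.1 v.2).pwCont).integrableOn hT).mono_set
      (hT.interior_hull_subset (hT.finite_elems.mem_toFinset.1 K.2))
  -- `Ψ` sends a family of polynomials of bounded degree, one triple per element, to its pairing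
  -- functional. Its domain is finite-dimensional and its range contains that of `Φ`.
  let Ψ : W →ₗ[ℝ] Module.Dual ℝ S := LinearMap.mk₂ ℝ
    (fun p v => ∑ K : ι, ∫ x in interior (hull K.1), ⟪(tof p K).toVField x, v.1 x⟫_ℝ)
    (fun p q v => by
      rw [← Finset.sum_add_distrib]
      refine Finset.sum_congr rfl fun K _ => ?_
      rw [← integral_add (hint _ _ _) (hint _ _ _)]
      congr 1; funext x
      rw [← inner_add_left]
      congr 1
      ext i; exact map_add (MvPolynomial.eval _) (p K i).1 (q K i).1)
    (fun c p v => by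
      rw [Finset.smul_sum]
      refine Finset.sum_congr rfl fun K _ => ?_
      rw [smul_eq_mul, ← integral_const_mul]
      congr 1; funext x
      rw [← real_inner_smul_left]
      congr 1
      ext i; exact MvPolynomial.smul_eval _ (p K i).1 c)
    (fun p u v => by
      rw [← Finset.sum_add_distrib]
      refine Finset.sum_congr rfl fun K _ => ?_
      rw [← integral_add (hint _ _ _) (hint _ _ _)]
      congr 1; funext x
      rw [← inner_add_right]
      rfl)
    (fun c p v => by
      rw [Finset.smul_sum]
      refine Finset.sum_congr rfl fun K _ => ?_
      rw [smul_eq_mul, ← integral_const_mul]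
      congr 1; funext x
      rw [← real_inner_smul_right]
      rfl)
  have hle : LinearMap.range Φ ≤ LinearMap.range Ψ := by
    rintro _ ⟨u, rfl⟩
    have hu (K : ι) := hP u.1 u.2 K.1 (hT.finite_elems.mem_toFinset.1 K.2)
    choose p hp hup using hu
    refine ⟨fun K i => ⟨p K i, (MvPolynomial.mem_restrictTotalDegree _ _ _).2 (hp K i)⟩, ?_⟩
    ext v
    change ∑ K : ι, _ = ip Ω u.1 v.1
    rw [ip, hT.integral_eq_sum (memLp_integrable_inner (hS u) (hS v)),
      ← Finset.sum_coe_sort hT.finite_elems.toFinset]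
    refine Finset.sum_congr rfl fun K _ => ?_
    refine setIntegral_congr_fun isOpen_interior.measurableSet fun x hx => ?_
    simp only [hup K hx]
    rfl
  have hfin : FiniteDimensional ℝ (LinearMap.range Φ) :=
    Submodule.finiteDimensional_of_le hle
  let L : Module.Dual ℝ S :=
    { toFun := fun u => ℓ u.1
      map_add' := fun u v => by
        have h := hℓ u.1 u.2 v.1 v.2 1 1
        simp only [one_smul, one_mul] at h
        exact h
      map_smul' := fun c u => by
        have h := hℓ u.1 u.2 u.1 u.2 c 0
        simp only [zero_smul, zero_mul, add_zero] at h
        exact h }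
  have hL : L ∈ LinearMap.range Φ := by
    -- A finite-dimensional subspace of the dual consists of all functionals vanishing on its common
    -- kernel. Here the common kernel consists of null fields, by pairing a field with itself, and
    -- `h0` applies.
    rw [← Subspace.dualCoannihilator_dualAnnihilator_eq (W := LinearMap.range Φ),
      Submodule.mem_dualAnnihilator]
    intro u hu
    rw [Submodule.mem_dualCoannihilator] at hu
    exact h0 u.1 u.2 (ae_eq_zero_of_ip_self (hS u) (hu (Φ u) ⟨u, rfl⟩))
  obtain ⟨P, hPL⟩ := hL
  exact ⟨P.1, P.2, fun C hC => LinearMap.congr_fun hPL ⟨C, hC⟩⟩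

variable {r : ℕ}

lemma rieszRep_spec {V : Set (VField d)} {ℓ : VField d → ℝ}
    (h : ∃ P ∈ V, ∀ C ∈ V, ip Ω P C = ℓ C) :
    rieszRep Ω V ℓ ∈ V ∧ ∀ C ∈ V, ip Ω (rieszRep Ω V ℓ) C = ℓ C :=
  Classical.epsilon_spec h

lemma l2Proj_RT_spec (hT : IsTriangulation T Ω) (hne : (RT Ω T r).Nonempty) {A : VField d}
    (hA : MemLp A 2 (volume.restrict Ω)) :
    l2Proj Ω (RT Ω T r) A ∈ RT Ω T r ∧
      ∀ C ∈ RT Ω T r, ip Ω (l2Proj Ω (RT Ω T r) A) C = ip Ω A C := by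
  have hL {u : VField d} (hu : u ∈ RT Ω T r) : MemLp u 2 (volume.restrict Ω) :=
    (pwPoly_of_mem_RT hu).memLp hT
  refine rieszRep_spec (exists_ip_eq hT isLinear_RT hne (fun u hu => pwPoly_of_mem_RT hu) _
    (fun u hu v hv a b => ip_linearComb_right (hL hu) (hL hv) hA a b) fun u _ h => ?_)
  rw [ip_congr (ae_eq_refl A) (g' := fun _ => 0) h]
  simp [ip]

/-- The functional uses the pointwise `curl`, so its linearity and its vanishing on null fields both
come from uniqueness of the weak curl. Nonemptiness is needed because `IsLinear` holds for the empty
set. -/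
lemma curlh_spec (hT : IsTriangulation T Ω) (hne : (AUX Ω T r).Nonempty) {B : VField d}
    (hB : MemLp B 2 (volume.restrict Ω)) :
    curlh Ω T r B ∈ AUX Ω T r ∧
      ∀ v ∈ AUX Ω T r, ip Ω (curlh Ω T r B) v = ip Ω B (curl v) := by
  have hL {u : VField d} (hu : u ∈ AUX Ω T r) := hasCurl0_of_mem_AUX hT hu
  refine rieszRep_spec (exists_ip_eq hT isLinear_AUX hne (fun u hu => pwPoly_of_mem_AUX hu) _
    (fun u hu v hv a b => ?_) fun u hu h => ?_)
  · rw [← ip_linearComb_right (hL hu).2.1 (hL hv).2.1 hB]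
    exact ip_congr (ae_eq_refl B) (HasCurl0.unique hT.isOpen (hL (isLinear_AUX u hu v hv a b))
      ((hL hu).linearComb (hL hv) a b) (ae_eq_refl _))
  · have h0 := (hL hu).linearComb (hL hu) 0 0
    have h1 := HasCurl0.unique hT.isOpen (hL hu) h0 (by
      filter_upwards [h] with x hx
      simp [hx])
    rw [ip_congr (ae_eq_refl B) h1]
    simp [ip]

/-! ### Traces and degenerate cases of the forms -/

lemma tr_eq_of_eqOn {F : Type*} [NormedAddCommGroup F] {K : Finset (Pt d)} (hK : K ∈ elems T)
    {f g : Pt d → F} (hg : Continuous g) (h : Set.EqOn f g (interior (hull K))) {x : Pt d}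
    (hx : x ∈ hull K) : tr K f x = g x :=
  extendFrom_eq (hull_subset_closure_interior hK hx)
    ((hg.continuousWithinAt (s := interior (hull K))).tendsto.congr'
      (h.symm.eventuallyEq_of_mem self_mem_nhdsWithin))

lemma diffTr_const {F : Type*} [NormedAddCommGroup F] {e : Finset (Pt d)} (he : e ∈ intFaces T)
    (c : F) {x : Pt d} (hx : x ∈ hull e) : diffTr T e (fun _ => c) x = 0 := by
  have hex : ∃ p : Finset (Pt d) × Finset (Pt d), IsSides T e p.1 p.2 := by
    obtain ⟨-, -, K₁, K₂, h⟩ := he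
    exact ⟨(K₁, K₂), h⟩
  obtain ⟨h1, h2, -, he1, he2⟩ : IsSides T e (sides T e).1 (sides T e).2 :=
    Classical.epsilon_spec hex
  rw [diffTr, tr_eq_of_eqOn h1 continuous_const (fun _ _ => rfl)
      (convexHull_mono (Finset.coe_subset.2 he1) hx),
    tr_eq_of_eqOn h2 continuous_const (fun _ _ => rfl)
      (convexHull_mono (Finset.coe_subset.2 he2) hx), sub_self]

lemma sumFaces_eq_zero {f : Finset (Pt d) → Pt d → ℝ}
    (h : ∀ e ∈ intFaces T, ∀ x ∈ hull e, f e x = 0) : sumFaces T f = 0 := by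
  unfold sumFaces
  rw [finsum_mem_congr rfl fun e he => setIntegral_eq_zero_of_forall_eq_zero (h e he)]
  simp

/-- This makes 1 a test function that yields conservation of mass. -/
lemma bForm_const (c : ℝ) (g : Pt d → ℝ) (u : VField d) : bForm T (fun _ => c) g u = 0 := by
  have h1 : sumElems T (fun x => adv u (fun _ : Pt d => c) x * g x) = 0 := by
    simp [sumElems, adv, pd_const]
  rw [bForm, h1, sumFaces_eq_zero fun e he x hx => by simp [jump, diffTr_const he c hx]]
  simp

/-- Both forms are antisymmetric in the last two arguments; on faces this uses `u × u = 0`, whatever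
the upwinding coefficients are. -/
lemma Regime.advForm_self (m : Regime d) (U w u : VField d) : m.advForm Ω T U w u u = 0 := by
  cases m with
  | viscous μ lam => simp [advForm, aForm, bracket, ip]
  | inviscid α =>
    have h1 : sumElems T (fun x => ⟪w x, adv u u x - adv u u x⟫_ℝ) = 0 := by simp [sumElems]
    rw [advForm, ahForm, h1, sumFaces_eq_zero fun e he x hx => by
      simp only [cross_self_eq_zero]
      rw [diffTr_const he (0 : Vec) hx, inner_zero_right]]
    simp

lemma Regime.viscForm_eq_zero {m : Regime d} (hm : m.NoViscosity) (u v : VField d) :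
    m.viscForm Ω u v = 0 := by
  cases m with
  | viscous μ lam =>
    obtain ⟨rfl, rfl⟩ := hm
    simp [viscForm, dForm]
  | inviscid α => rfl

/-! ### The energy -/

section PwContAlgebra

lemma PwCont.add {F : Type*} [NormedAddCommGroup F] {f g : Pt d → F} (hf : PwCont T f) (hg : PwCont T g) :
    PwCont T fun x => f x + g x := hf.comp₂ hg (φ := fun a b => a + b) (by fun_prop)

lemma PwCont.sub {F : Type*} [NormedAddCommGroup F] {f g : Pt d → F} (hf : PwCont T f) (hg : PwCont T g) :
    PwCont T fun x => f x - g x := hf.comp₂ hg (φ := fun a b => a - b) (by fun_prop)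

variable {F : Type*} [NormedAddCommGroup F] [NormedSpace ℝ F]

lemma PwCont.smul {f : Pt d → ℝ} {g : Pt d → F} (hf : PwCont T f) (hg : PwCont T g) :
    PwCont T fun x => f x • g x := hf.comp₂ hg (φ := fun a b => a • b) (by fun_prop)

lemma PwCont.mul {f g : Pt d → ℝ} (hf : PwCont T f) (hg : PwCont T g) :
    PwCont T fun x => f x * g x := hf.comp₂ hg (φ := fun a b => a * b) (by fun_prop)

lemma PwCont.mid {f g : Pt d → F} (hf : PwCont T f) (hg : PwCont T g) :
    PwCont T (mid f g) := (PwCont.const (1 / 2 : ℝ)).smul (hf.add hg)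

lemma PwCont.dt {f g : Pt d → F} (hf : PwCont T f) (hg : PwCont T g) (Δt : ℝ) :
    PwCont T (dt Δt f g) := (PwCont.const (1 / Δt)).smul (hg.sub hf)

end PwContAlgebra

/-- Values in `I` on the closed element keep `ε ∘ ρ` continuous up to its boundary, and hence
integrable. -/
lemma pwCont_comp_of_mem_DG {s : ℕ} {ρ : Pt d → ℝ} (hρ : ρ ∈ DG T s) {ε : ℝ → ℝ} {I : Set ℝ}
    (hε : ContinuousOn ε I) (hρI : ∀ K ∈ elems T, ∀ x ∈ hull K, tr K ρ x ∈ I) :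
    PwCont T fun x => ε (ρ x) := fun K hK => by
  obtain ⟨p, -, hp⟩ := hρ K hK
  have hc : Continuous (polyFun p) := (contDiff_polyFun p).continuous
  refine ⟨fun x => ε (polyFun p x), hε.comp hc.continuousOn fun x hx => ?_, fun x hx => ?_⟩
  · rw [← tr_eq_of_eqOn hK hc hp hx]
    exact hρI K hK x hx
  · simp only [hp x hx]; rfl

lemma diffQuot_mul (ε : ℝ → ℝ) (x y : ℝ) : diffQuot ε x y * (y - x) = ε y - ε x := by
  unfold diffQuot
  split_ifs with h
  · simp [h]
  · exact div_mul_cancel₀ _ (sub_ne_zero.2 h)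

/-- The energy density `½ ρ |u|² + ε(ρ) + ½ |B|²`. -/
noncomputable def energyDensity (ε : ℝ → ℝ) (u : VField d) (ρ : Pt d → ℝ) (B : VField d)
    (x : Pt d) : ℝ :=
  (1 / 2) * (ρ x * ⟪u x, u x⟫_ℝ) + ε (ρ x) + (1 / 2) * ⟪B x, B x⟫_ℝ

lemma pwCont_energyDensity {ε : ℝ → ℝ} {u : VField d} {ρ : Pt d → ℝ} {B : VField d}
    (hu : PwCont T u) (hρ : PwCont T ρ) (hε : PwCont T fun x => ε (ρ x)) (hB : PwCont T B) :
    PwCont T (energyDensity ε u ρ B) :=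
  (((PwCont.const _).mul (hρ.mul (hu.inner hu))).add hε).add
    ((PwCont.const _).mul (hB.inner hB))

lemma energy_eq (hT : IsTriangulation T Ω) {ε : ℝ → ℝ} {u : VField d} {ρ : Pt d → ℝ}
    {B : VField d} (hu : PwCont T u) (hρ : PwCont T ρ) (hε : PwCont T fun x => ε (ρ x))
    (hB : PwCont T B) : energy Ω ε u ρ B = ∫ x in Ω, energyDensity ε u ρ B x := by
  have h1 : IntegrableOn (fun x => ⟪ρ x • u x, u x⟫_ℝ) Ω := ((hρ.smul hu).inner hu).integrableOn hT
  have e (x : Pt d) : (1 / 2) * ρ x * ‖u x‖ ^ 2 - ε (ρ x) - (1 / 2) * ‖B x‖ ^ 2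
      = ⟪ρ x • u x, u x⟫_ℝ - energyDensity ε u ρ B x := by
    rw [energyDensity, real_inner_smul_left, ← real_inner_self_eq_norm_sq,
      ← real_inner_self_eq_norm_sq]
    ring
  rw [energy, lagrangian, ip]
  simp only [e]
  rw [integral_sub h1 ((pwCont_energyDensity hu hρ hε hB).integrableOn hT)]
  ring

/-- Pointwise, `½(ρ₁|u₁|² - ρ₀|u₀|²) = (ρ₁u₁ - ρ₀u₀)·½(u₀ + u₁) - ½ u₀·u₁ (ρ₁ - ρ₀)`, while `δ`
times the density increment is the increment of `ε`. This is why θ is built from `½ u₀·u₁ - δ`. -/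
lemma energy_sub_div (hT : IsTriangulation T Ω) {ε : ℝ → ℝ} {Δt : ℝ} (hΔt : Δt ≠ 0)
    {u₀ u₁ : VField d} {ρ₀ ρ₁ : Pt d → ℝ} {B₀ B₁ : VField d}
    (hu₀ : PwCont T u₀) (hρ₀ : PwCont T ρ₀) (hε₀ : PwCont T fun x => ε (ρ₀ x))
    (hB₀ : PwCont T B₀) (hu₁ : PwCont T u₁) (hρ₁ : PwCont T ρ₁)
    (hε₁ : PwCont T fun x => ε (ρ₁ x)) (hB₁ : PwCont T B₁) :
    (energy Ω ε u₁ ρ₁ B₁ - energy Ω ε u₀ ρ₀ B₀) / Δt =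
      ip Ω (dt Δt (fun x => ρ₀ x • u₀ x) fun x => ρ₁ x • u₁ x) (mid u₀ u₁)
      - ip Ω (fun x => (1 / 2) * ⟪u₀ x, u₁ x⟫_ℝ - diffQuot ε (ρ₀ x) (ρ₁ x)) (dt Δt ρ₀ ρ₁)
      + ip Ω (dt Δt B₀ B₁) (mid B₀ B₁) := by
  have h1 : IntegrableOn (fun x => ⟪dt Δt (fun x => ρ₀ x • u₀ x) (fun x => ρ₁ x • u₁ x) x,
      mid u₀ u₁ x⟫_ℝ) Ω :=
    (((hρ₀.smul hu₀).dt (hρ₁.smul hu₁) Δt).inner (hu₀.mid hu₁)).integrableOn hT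
  have h2 : IntegrableOn (fun x => ⟪dt Δt B₀ B₁ x, mid B₀ B₁ x⟫_ℝ) Ω :=
    ((hB₀.dt hB₁ Δt).inner (hB₀.mid hB₁)).integrableOn hT
  -- After multiplication by the density increment the difference quotient disappears, so no
  -- regularity of `diffQuot` is needed for integrability.
  have e (x : Pt d) : ⟪(1 / 2) * ⟪u₀ x, u₁ x⟫_ℝ - diffQuot ε (ρ₀ x) (ρ₁ x), dt Δt ρ₀ ρ₁ x⟫_ℝ
      = (1 / Δt) * ((1 / 2) * ⟪u₀ x, u₁ x⟫_ℝ * (ρ₁ x - ρ₀ x) - (ε (ρ₁ x) - ε (ρ₀ x))) := by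
    rw [← diffQuot_mul]
    simp only [dt, smul_eq_mul, RCLike.inner_apply, conj_trivial]
    ring
  have h3 : IntegrableOn (fun x => ⟪(1 / 2) * ⟪u₀ x, u₁ x⟫_ℝ - diffQuot ε (ρ₀ x) (ρ₁ x),
      dt Δt ρ₀ ρ₁ x⟫_ℝ) Ω := by
    simp only [e]
    exact ((PwCont.const _).mul ((((PwCont.const _).mul (hu₀.inner hu₁)).mul (hρ₁.sub hρ₀)).sub
      (hε₁.sub hε₀))).integrableOn hT
  rw [energy_eq hT hu₀ hρ₀ hε₀ hB₀, energy_eq hT hu₁ hρ₁ hε₁ hB₁,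
    ← integral_sub ((pwCont_energyDensity hu₁ hρ₁ hε₁ hB₁).integrableOn hT)
      ((pwCont_energyDensity hu₀ hρ₀ hε₀ hB₀).integrableOn hT), ← integral_div]
  simp only [ip]
  have h13 := h1.sub h3
  simp only [Pi.sub_def] at h13
  rw [← integral_sub h1 h3, ← integral_add h13 h2]
  congr 1
  funext x
  rw [e]
  simp only [dt, mid, energyDensity, real_inner_smul_left, real_inner_smul_right, inner_sub_left,
    inner_add_right, real_inner_comm (u₀ x) (u₁ x), real_inner_comm (B₀ x) (B₁ x)]
  field_simp
  ring

/-! ### One time step -/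

section Step

variable {r s : ℕ} {m : Regime d} {ν : ℝ} {ε : ℝ → ℝ} {Δt : ℝ} {u₀ u₁ : VField d}
  {ρ₀ ρ₁ : Pt d → ℝ} {B₀ B₁ : VField d} {θ : Pt d → ℝ} {J H U E α : VField d}

/-- Faraday's law holds pointwise almost everywhere. -/
lemma StepEqs.faraday (hd : d = 2 ∨ d = 3) (hT : IsTriangulation T Ω)
    (hB₀ : B₀ ∈ RT Ω T r) (hB₁ : B₁ ∈ RT Ω T r)
    (h : StepEqs Ω T r s m ν ε Δt u₀ ρ₀ B₀ u₁ ρ₁ B₁ θ J H U E α) :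
    dt Δt B₀ B₁ =ᵐ[volume.restrict Ω] fun x => (-1 : ℝ) • curl E x + (-ν) • curl J x := by
  have hL {u : VField d} (hu : u ∈ RT Ω T r) : MemLp u 2 (volume.restrict Ω) :=
    (pwPoly_of_mem_RT hu).memLp hT
  have hE := curl_mem_RT hd hT h.mem_E
  have hJ := curl_mem_RT hd hT h.mem_J
  have hD := isLinear_RT.dt hB₀ hB₁ Δt
  have hS := isLinear_RT _ hE _ hJ 1 ν
  have hR := isLinear_RT _ hD _ hS 1 1
  -- The residual `hR` of the magnetic equation lies in `RT`, so the equation can be tested with the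
  -- residual itself.
  have h0 := ae_eq_zero_of_ip_self (hL hR) (by
    rw [ip_linearComb_left (hL hD) (hL hS) (hL hR), ip_linearComb_left (hL hE) (hL hJ) (hL hR)]
    linarith [h.magnetic _ hR])
  filter_upwards [h0] with x hx
  simp only [one_smul] at hx
  rw [eq_neg_of_add_eq_zero_left hx]
  module

lemma integral_density_eq (hT : IsTriangulation T Ω) (hΔt : Δt ≠ 0) (hρ₀ : ρ₀ ∈ DG T s)
    (hρ₁ : ρ₁ ∈ DG T s) (h : StepEqs Ω T r s m ν ε Δt u₀ ρ₀ B₀ u₁ ρ₁ B₁ θ J H U E α) :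
    ∫ x in Ω, ρ₁ x = ∫ x in Ω, ρ₀ x := by
  -- The constant 1 has degree 0, so it is in `DG T s` for every `s`.
  have h1 := h.density (fun _ => 1) fun K _ => ⟨1, by simp, by simp⟩
  rw [bForm_const, add_zero, ip] at h1
  have e (x : Pt d) : ⟪dt Δt ρ₀ ρ₁ x, (1 : ℝ)⟫_ℝ = (1 / Δt) * (ρ₁ x - ρ₀ x) := by simp [dt]
  simp only [e] at h1
  rw [integral_const_mul, integral_sub ((pwCont_of_mem_DG hρ₁).integrableOn hT)
    ((pwCont_of_mem_DG hρ₀).integrableOn hT)] at h1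
  have h2 : (1 / Δt) ≠ 0 := one_div_ne_zero hΔt
  exact sub_eq_zero.1 ((mul_eq_zero.1 h1).resolve_left h2)

lemma ip_cross_swap (u v w : VField d) :
    ip Ω (fun x => cross (u x) (v x)) w = -ip Ω (fun x => cross (w x) (v x)) u := by
  rw [ip, ip, ← integral_neg]
  simp only [inner_cross_swap (u _) (v _) (w _)]

/-- The energy balance of one time step. -/
lemma StepEqs.energy_balance (hT : IsTriangulation T Ω) (hΔt : Δt ≠ 0)
    (hu₀ : u₀ ∈ m.velSpace Ω T r) (hu₁ : u₁ ∈ m.velSpace Ω T r)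
    (hρ₀ : ρ₀ ∈ DG T s) (hρ₁ : ρ₁ ∈ DG T s)
    (hε₀ : PwCont T fun x => ε (ρ₀ x)) (hε₁ : PwCont T fun x => ε (ρ₁ x))
    (hB₀ : B₀ ∈ RT Ω T r) (hB₁ : B₁ ∈ RT Ω T r)
    (h : StepEqs Ω T r s m ν ε Δt u₀ ρ₀ B₀ u₁ ρ₁ B₁ θ J H U E α) :
    (energy Ω ε u₁ ρ₁ B₁ - energy Ω ε u₀ ρ₀ B₀) / Δt =
      m.viscForm Ω (mid u₀ u₁) (mid u₀ u₁) + eForm Ω T r ν (mid B₀ B₁) (mid B₀ B₁) := by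
  have hBm := isLinear_RT.mid hB₀ hB₁
  have hP := curlh_spec hT ⟨J, h.mem_J⟩ ((pwPoly_of_mem_RT hBm).memLp hT)
  rw [energy_sub_div hT hΔt (pwPoly_of_mem_velSpace hu₀).pwCont (pwCont_of_mem_DG hρ₀) hε₀
    (pwPoly_of_mem_RT hB₀).pwCont (pwPoly_of_mem_velSpace hu₁).pwCont (pwCont_of_mem_DG hρ₁) hε₁
    (pwPoly_of_mem_RT hB₁).pwCont, eForm]
  have e1 := h.velocity _ ((isLinear_velSpace m).mid hu₀ hu₁)
  rw [Regime.advForm_self] at e1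
  -- With σ = θ the form `bForm` takes the same value as in the velocity equation tested with the
  -- midpoint velocity, and the two cancel. Testing the equation for θ with `dt Δt ρ₀ ρ₁` produces
  -- the density term of `energy_sub_div`.
  have e2 := h.density θ h.mem_θ
  have e3 := h.eq_θ _ (isLinear_DG.dt hρ₀ hρ₁ Δt)
  have e4 := h.magnetic _ hBm
  have e5 := h.eq_J E h.mem_E
  have e6 := h.eq_J J h.mem_J
  -- With `e5` and `e8`–`e10`: `⟨α, u⟩ = ⟨α, U⟩ = -⟨J × H, U⟩ = ⟨U × H, J⟩ = -⟨E, J⟩ = -⟨curl E,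
  -- B⟩`, with `u` and `B` at the midpoint. This cancels the term `⟨curl E, B⟩` of the magnetic
  -- equation.
  have e7 := h.eq_U α h.mem_α
  have e8 := h.eq_α U h.mem_U
  have e9 := h.eq_E J h.mem_J
  have e10 := ip_cross_swap (Ω := Ω) U H J
  have e11 := hP.2 _ hP.1
  have e12 := hP.2 _ h.mem_J
  have e13 := h.eq_J _ hP.1
  rw [ip_comm θ] at e3
  rw [ip_comm J E, ip_comm (mid B₀ B₁)] at e5
  rw [ip_comm (mid B₀ B₁)] at e6
  rw [ip_comm U α, ip_comm _ α] at e7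
  rw [ip_comm _ J, ip_comm (mid B₀ B₁)] at e12
  -- `J` and `curlh` represent the same functional on `AUX`; the identity follows by testing each
  -- with the other, without identifying them as functions.
  have e14 : ip Ω (curlh Ω T r (mid B₀ B₁)) (curlh Ω T r (mid B₀ B₁)) = ip Ω (curl J) (mid B₀ B₁) := by
    rw [e11, ← e13, e12]
  rw [e14]
  linarith

/-- In two dimensions magnetic fields are orthogonal to electric fields. -/
lemma ip_RT_AUX_eq_zero (hT : IsTriangulation T Ω) (h2 : d = 2) {B E : VField d}
    (hB : B ∈ RT Ω T r) (hE : E ∈ AUX Ω T r) : ip Ω B E = 0 := by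
  rw [AUX, if_pos h2] at hE
  refine integral_eq_zero_of_ae (hT.ae_of_forall fun K hK x hx => ?_)
  obtain ⟨p, q, hp, -, -, hBp⟩ := hB.2 K hK
  obtain ⟨p', hp', -, hEp⟩ := hE.2 K hK
  have hemb : emb x 2 = 0 := by simp [emb, h2]
  have hB2 : B x 2 = 0 := by rw [hBp x hx]; simp [VPoly.toVField, hp h2, hemb]
  have hE0 : E x 0 = 0 := by rw [hEp x hx]; simp [VPoly.toVField, (hp' h2).1]
  have hE1 : E x 1 = 0 := by rw [hEp x hx]; simp [VPoly.toVField, (hp' h2).2]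
  simp [inner_vec, hB2, hE0, hE1]

/-- The electric field does no work on the magnetic field. -/
lemma StepEqs.ip_mid_E (hT : IsTriangulation T Ω) (hB₀ : B₀ ∈ RT Ω T r) (hB₁ : B₁ ∈ RT Ω T r)
    (h : StepEqs Ω T r s m ν ε Δt u₀ ρ₀ B₀ u₁ ρ₁ B₁ θ J H U E α) :
    ip Ω (mid B₀ B₁) E = 0 := by
  by_cases h2 : d = 2
  · exact ip_RT_AUX_eq_zero hT h2 (isLinear_RT.mid hB₀ hB₁) h.mem_E
  · have hAUX : AUX Ω T r = NED Ω T r := if_neg h2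
    -- In three dimensions `AUX` is `NED`, so `E` may test the equation of `H` and `H` that of `E`:
    -- `⟨B, E⟩ = ⟨H, E⟩ = -⟨U × H, H⟩ = 0`.
    rw [← h.eq_H E (hAUX ▸ h.mem_E), ip_comm, h.eq_E H (hAUX.symm ▸ h.mem_H)]
    simp [ip, inner_cross_self]

/-- The balance of magnetic helicity in one time step. -/
lemma StepEqs.helicity_balance (hd : d = 2 ∨ d = 3) (hT : IsTriangulation T Ω)
    (hB₀ : B₀ ∈ RT Ω T r) (hB₁ : B₁ ∈ RT Ω T r)
    (h : StepEqs Ω T r s m ν ε Δt u₀ ρ₀ B₀ u₁ ρ₁ B₁ θ J H U E α) {A₀ A₁ : VField d}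
    (hA₀ : HasCurl0 Ω A₀ B₀) (hA₁ : HasCurl0 Ω A₁ B₁) :
    (1 / Δt) * (ip Ω A₁ B₁ - ip Ω A₀ B₀) =
      2 * eForm Ω T r ν (mid B₀ B₁) (l2Proj Ω (RT Ω T r) (mid A₀ A₁)) := by
  have hL {u : VField d} (hu : u ∈ RT Ω T r) : MemLp u 2 (volume.restrict Ω) :=
    (pwPoly_of_mem_RT hu).memLp hT
  have hmid (f g : VField d) :
      mid f g = fun x => (1 / 2 : ℝ) • f x + (1 / 2 : ℝ) • g x := by
    funext x; simp [mid]
  have hAm : HasCurl0 Ω (mid A₀ A₁) (mid B₀ B₁) := by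
    rw [hmid, hmid]; exact hA₀.linearComb hA₁ _ _
  have hD := isLinear_RT.dt hB₀ hB₁ Δt
  have hBm := isLinear_RT.mid hB₀ hB₁
  have hdt : dt Δt B₀ B₁ = fun x => (-(1 / Δt)) • B₀ x + (1 / Δt) • B₁ x := by
    funext x; simp only [dt]; module
  have hcurlE := curl_mem_RT hd hT h.mem_E
  have hcurlJ := curl_mem_RT hd hT h.mem_J
  -- Symmetry of the curl gives `⟨A₁, B₀⟩ = ⟨A₀, B₁⟩`, so the cross terms in the product of midpoint
  -- and increment cancel.
  have e1 : (1 / Δt) * (ip Ω A₁ B₁ - ip Ω A₀ B₀) = 2 * ip Ω (mid A₀ A₁) (dt Δt B₀ B₁) := by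
    have hs := HasCurl0.ip_comm hA₀ hA₁
    rw [ip_comm] at hs
    rw [hdt, ip_linearComb_right (hL hB₀) (hL hB₁) hAm.1, hmid,
      ip_linearComb_left hA₀.1 hA₁.1 (hL hB₀), ip_linearComb_left hA₀.1 hA₁.1 (hL hB₁), hs]
    ring
  have e2 : ip Ω (mid A₀ A₁) (curl E) = 0 := by
    rw [← HasCurl0.ip_comm hAm (hasCurl0_of_mem_AUX hT h.mem_E), h.ip_mid_E hT hB₀ hB₁]
  obtain ⟨hπ, hπ'⟩ := l2Proj_RT_spec hT ⟨B₀, hB₀⟩ hAm.1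
  obtain ⟨hC, hC'⟩ := curlh_spec hT ⟨J, h.mem_J⟩ (hL hπ)
  obtain ⟨-, hP'⟩ := curlh_spec hT ⟨J, h.mem_J⟩ (hL hBm)
  -- Since `curl J` is in `RT`, the potential may be replaced by its projection. The discrete curl
  -- then moves onto the projection, and `J` is exchanged for the discrete curl of the midpoint
  -- field.
  have e3 : ip Ω (mid A₀ A₁) (curl J) = ip Ω (curlh Ω T r (mid B₀ B₁))
      (curlh Ω T r (l2Proj Ω (RT Ω T r) (mid A₀ A₁))) := by
    rw [hP' _ hC, ← h.eq_J _ hC, ip_comm J, hC' J h.mem_J, hπ' _ hcurlJ]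
  rw [e1, ip_congr (ae_eq_refl _) (h.faraday hd hT hB₀ hB₁),
    ip_linearComb_right (hL hcurlE) (hL hcurlJ) hAm.1, e2, e3, eForm]
  ring

/-- By Faraday's law `B₁` is almost everywhere `B₀` plus `Δt` times a combination of curls. -/
lemma StepEqs.isDivFree (hd : d = 2 ∨ d = 3) (hT : IsTriangulation T Ω) (hΔt : Δt ≠ 0)
    (hB₀ : B₀ ∈ RT Ω T r) (hB₁ : B₁ ∈ RT Ω T r)
    (h : StepEqs Ω T r s m ν ε Δt u₀ ρ₀ B₀ u₁ ρ₁ B₁ θ J H U E α) (h0 : IsDivFree Ω B₀) :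
    IsDivFree Ω B₁ := by
  have hE := hasCurl0_of_mem_AUX hT h.mem_E
  have hJ := hasCurl0_of_mem_AUX hT h.mem_J
  have hS := (IsDivFree_of_inClosure (HasCurl0.inClosure_dv hE)).linearComb
    (IsDivFree_of_inClosure (HasCurl0.inClosure_dv hJ)) hE.2.1 hJ.2.1 (a := -1) (b := -ν)
    (ae_eq_refl _)
  refine h0.linearComb hS ((pwPoly_of_mem_RT hB₀).memLp hT)
    ((hE.2.1.const_smul (-1 : ℝ)).add (hJ.2.1.const_smul (-ν))) (a := 1) (b := Δt) ?_
  filter_upwards [h.faraday hd hT hB₀ hB₁] with x hx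
  rw [← hx, dt, smul_smul, mul_one_div_cancel hΔt]
  module

end Step

end CompressibleMHD

open CompressibleMHD
theorem proposition2 {d : ℕ} (hd : d = 2 ∨ d = 3) (Ω : Set (Pt d))
    (T : Geometry.SimplicialComplex ℝ (Pt d)) (hT : IsTriangulation T Ω) (r s : ℕ)
    (m : Regime d) (ν : ℝ) (ε : ℝ → ℝ) (I : Set ℝ) (hI : IsOpen I) (hε : ContDiffOn ℝ 1 ε I)
    (Δt : ℝ) (hΔt : 0 < Δt) (N : ℕ)
    (u : ℕ → VField d) (ρ : ℕ → Pt d → ℝ) (B : ℕ → VField d)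
    (hu : ∀ k ≤ N, u k ∈ m.velSpace Ω T r) (hρ : ∀ k ≤ N, ρ k ∈ DG T s)
    (hB : ∀ k ≤ N, B k ∈ RT Ω T r)
    (hρI : ∀ k ≤ N, ∀ K ∈ elems T, ∀ x ∈ hull K, tr K (ρ k) x ∈ I)
    (hstep : ∀ k < N,
      IsStep Ω T r s m ν ε Δt (u k) (ρ k) (B k) (u (k + 1)) (ρ (k + 1)) (B (k + 1)))
    (hB0 : IsDivFree Ω (B 0)) :
    (∀ k ≤ N, IsDivFree Ω (B k)) ∧
    (∀ k < N, ∫ x in Ω, ρ (k + 1) x = ∫ x in Ω, ρ k x) ∧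
    (∀ k < N,
      (energy Ω ε (u (k + 1)) (ρ (k + 1)) (B (k + 1)) - energy Ω ε (u k) (ρ k) (B k)) / Δt =
        m.viscForm Ω (mid (u k) (u (k + 1))) (mid (u k) (u (k + 1))) +
          eForm Ω T r ν (mid (B k) (B (k + 1))) (mid (B k) (B (k + 1)))) ∧
    (∀ k < N, ∀ A A' : VField d, HasCurl0 Ω A (B k) → HasCurl0 Ω A' (B (k + 1)) →
      (1 / Δt) * (ip Ω A' (B (k + 1)) - ip Ω A (B k)) =
        2 * eForm Ω T r ν (mid (B k) (B (k + 1))) (l2Proj Ω (RT Ω T r) (mid A A'))) ∧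
    (m.NoViscosity → ν = 0 → ∀ k < N,
      energy Ω ε (u (k + 1)) (ρ (k + 1)) (B (k + 1)) = energy Ω ε (u k) (ρ k) (B k)) ∧
    (ν = 0 → ∀ k < N, ∀ A A' : VField d, HasCurl0 Ω A (B k) → HasCurl0 Ω A' (B (k + 1)) →
      ip Ω A' (B (k + 1)) = ip Ω A (B k)) := by
  have hΔt' : Δt ≠ 0 := hΔt.ne'
  have hερ (k : ℕ) (hk : k ≤ N) : PwCont T fun x => ε (ρ k x) :=
    pwCont_comp_of_mem_DG (hρ k hk) hε.continuousOn (hρI k hk)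
  have energy_balance : ∀ k < N,
      (energy Ω ε (u (k + 1)) (ρ (k + 1)) (B (k + 1)) - energy Ω ε (u k) (ρ k) (B k)) / Δt =
        m.viscForm Ω (mid (u k) (u (k + 1))) (mid (u k) (u (k + 1))) +
          eForm Ω T r ν (mid (B k) (B (k + 1))) (mid (B k) (B (k + 1))) := fun k hk => by
    obtain ⟨θ, J, H, U, E, α, h⟩ := hstep k hk
    exact h.energy_balance hT hΔt' (hu k hk.le) (hu _ hk) (hρ k hk.le) (hρ _ hk) (hερ k hk.le)
      (hερ _ hk) (hB k hk.le) (hB _ hk)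
  have helicity_balance : ∀ k < N, ∀ A A' : VField d, HasCurl0 Ω A (B k) →
      HasCurl0 Ω A' (B (k + 1)) → (1 / Δt) * (ip Ω A' (B (k + 1)) - ip Ω A (B k)) =
        2 * eForm Ω T r ν (mid (B k) (B (k + 1))) (l2Proj Ω (RT Ω T r) (mid A A')) :=
    fun k hk A A' hA hA' => by
    obtain ⟨θ, J, H, U, E, α, h⟩ := hstep k hk
    exact h.helicity_balance hd hT (hB k hk.le) (hB _ hk) hA hA'
  refine ⟨fun k => ?_, fun k hk => ?_, energy_balance, helicity_balance, fun hm hν k hk => ?_,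
    fun hν k hk A A' hA hA' => ?_⟩
  · induction k with
    | zero => exact fun _ => hB0
    | succ k ih =>
      intro hk
      obtain ⟨θ, J, H, U, E, α, h⟩ := hstep k hk
      exact h.isDivFree hd hT hΔt' (hB k (Nat.le_of_succ_le hk)) (hB _ hk)
        (ih (Nat.le_of_succ_le hk))
  · obtain ⟨θ, J, H, U, E, α, h⟩ := hstep k hk
    exact integral_density_eq hT hΔt' (hρ k hk.le) (hρ _ hk) h
  · have h := energy_balance k hk
    rw [Regime.viscForm_eq_zero hm, eForm, hν, neg_zero, zero_mul, add_zero,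
      div_eq_zero_iff] at h
    exact sub_eq_zero.1 (h.resolve_right hΔt')
  · have h := helicity_balance k hk A A' hA hA'
    rw [eForm, hν, neg_zero, zero_mul, mul_zero, mul_eq_zero] at h
    exact sub_eq_zero.1 (h.resolve_left (one_div_ne_zero hΔt'))
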